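/- Let $\vdash$ denote derivability in $ZF$ (classical first-order logic with equality in the language $\{\in\}$; axioms: extensionality, separation, pairing, union, powerset, replacement, infinity, foundation). Let $\mathbb{DCL}[ZF]$ be the category of definable classes: its objects are formulas $\{x\mid P\}$ in one variable; an arrow $\{x\mid P\}\to\{y\mid Q\}$ is a class $[F]$ of formulas $F(x,y)$, modulo provable equivalence ($F\equiv F'$ iff $\vdash F\leftrightarrow F'$), such that $F(x,y)\vdash P(x)\wedge Q(y)$, $\;F(x,y)\wedge F(x,y')\vdash y=y'$ and $P(x)\vdash\exists y\,F(x,y)$; the composite of $[F]$ and $[G]$ is $[\exists y(F(x,y)\wedge G(y,z))]$ and identities are $[P(x)\wedge x=x']$. Let $\mathcal S$ be the class of arrows $[F]$ with $$\vdash\forall y\,\exists z\,\forall x\,(F(x,y)\leftrightarrow x\in z).$$ Then $\mathbb{DCL}[ZF]$ is a regular category and $\mathcal S$ is a class of small maps in it in the sense of Simpson, that is: 1. if $f,g\in\mathcal S$ are composable, then $g\circ f\in\mathcal S$; 2. every monomorphism is in $\mathcal S$; 3. (stability) every pullback of an arrow of $\mathcal S$ is in $\mathcal S$; 4. (representability)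 for every object $X$ there are objects $\mathcal P_{\mathcal S}(X)$ and $\in_X$ and a monomorphism $e_X:\in_X\to X\times\mathcal P_{\mathcal S}(X)$ with $\pi_2\circ e_X\in\mathcal S$ such that for every monomorphism $\psi:R\to X\times Z$ with $\pi_2\circ\psi\in\mathcal S$ there is a unique $\rho:Z\to\mathcal P_{\mathcal S}(X)$ for which $\psi$ is a pullback of $e_X$ along $\mathrm{id}_X\times\rho$ (i.e. there is an arrow $R\to\in_X$ completing $\psi$, $e_X$ and $\mathrm{id}_X\times\rho$ to a pullback square); 5. (powerset) for every $X$ and every such $e_X:\in_X\to X\times\mathcal P_{\mathcal S}(X)$ there is a monomorphism $\sqsubseteq_X:\subseteq_X\to\mathcal P_{\mathcal S}(X)\times\mathcal P_{\mathcal S}(X)$ with $\pi_2\circ\sqsubseteq_X\in\mathcal S$ such that an arrow $\langle f_1,f_2\rangle:Z\to\mathcal P_{\mathcal S}(X)\times\mathcal P_{\mathcal S}(X)$ factors through $\sqsubseteq_X$ if and only if the pullback of $e_X$ along $\mathrm{id}_X\times f_1$ factors through the pullback of $e_X$ along $\mathrm{id}_X\times f_2$, over $X\times Z$. Moreover, the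 small definable classes are exactly the definable sets: for every object $X=\{x\mid P\}$ and every terminal object $1$, the unique arrow $X\to 1$ is in $\mathcal S$ if and only if $\vdash\exists z\,\forall x\,(x\in z\leftrightarrow P(x))$. -/

import Mathlib

open CategoryTheory CategoryTheory.Limits FirstOrder FirstOrder.Language

namespace ZFClasses

/-! ## First-order formulas over membership and their derivations -/

/-- The only non-logical symbol: a binary relation. -/
inductive MemSymbol : ℕ → Type
  | mem : MemSymbol 2

/-- The first-order language of set theory: no function symbols, one binary relation symbol. -/
def setLang : FirstOrder.Language.{0, 0} := ⟨fun _ => Empty, MemSymbol⟩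

/-- Formulas with named free variables in `α` and `n` further numbered variables. -/
abbrev Fml (α : Type) (n : ℕ) := setLang.BoundedFormula α n

/-- A change of variables, extended to one more bound variable. -/
def liftVar {α β : Type} {n m : ℕ} (σ : α ⊕ Fin n → β ⊕ Fin m) :
    α ⊕ Fin (n + 1) → β ⊕ Fin (m + 1) :=
  Sum.elim (fun a => Sum.map id Fin.castSucc (σ (Sum.inl a)))
    (Fin.lastCases (Sum.inr (Fin.last m)) fun i => Sum.map id Fin.castSucc (σ (Sum.inr i)))

/-- Capture-free substitution of variables for variables. -/
def ren {α β : Type} : {n : ℕ} → Fml α n → {m : ℕ} → (α ⊕ Fin n → β ⊕ Fin m) → Fml β m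
  | _, .falsum, _, _ => .falsum
  | _, .equal s t, _, σ => .equal (s.relabel σ) (t.relabel σ)
  | _, .rel R ts, _, σ => .rel R fun i => (ts i).relabel σ
  | _, .imp φ ψ, _, σ => .imp (ren φ σ) (ren ψ σ)
  | _, .all φ, _, σ => .all (ren φ (liftVar σ))

/-- The variables of a derivation are `v₀, v₁, v₂, …`; `inst φ k` is `φ[vₖ/x]`, where `x` is the
only numbered variable of `φ`. -/
def inst (φ : Fml ℕ 1) (k : ℕ) : Fml ℕ 0 :=
  ren φ (Sum.elim Sum.inl fun _ => Sum.inl k)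

/-- The equation `vⱼ = vₖ`. -/
def varEq (j k : ℕ) : Fml ℕ 0 :=
  .equal (.var (Sum.inl j)) (.var (Sum.inl k))

/-- Natural deduction for classical first-order logic with equality. The only terms of the language
are the variables; the primitive connectives are `⊥`, `→`, `∀` (and `=`). -/
inductive Deriv : Set (Fml ℕ 0) → Fml ℕ 0 → Prop
  | hyp {Γ : Set (Fml ℕ 0)} {φ : Fml ℕ 0} : φ ∈ Γ → Deriv Γ φ
  | weaken {Γ Δ : Set (Fml ℕ 0)} {φ : Fml ℕ 0} : Γ ⊆ Δ → Deriv Γ φ → Deriv Δ φ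
  | impI {Γ : Set (Fml ℕ 0)} {φ ψ : Fml ℕ 0} : Deriv (insert φ Γ) ψ → Deriv Γ (.imp φ ψ)
  | impE {Γ : Set (Fml ℕ 0)} {φ ψ : Fml ℕ 0} : Deriv Γ (.imp φ ψ) → Deriv Γ φ → Deriv Γ ψ
  | raa {Γ : Set (Fml ℕ 0)} {φ : Fml ℕ 0} :
      Deriv (insert (.imp φ .falsum) Γ) .falsum → Deriv Γ φ
  | allI {Γ : Set (Fml ℕ 0)} {φ : Fml ℕ 1} (k : ℕ) : (∀ ψ ∈ Γ, k ∉ ψ.freeVarFinset) →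
      k ∉ φ.freeVarFinset → Deriv Γ (inst φ k) → Deriv Γ (.all φ)
  | allE {Γ : Set (Fml ℕ 0)} {φ : Fml ℕ 1} (k : ℕ) : Deriv Γ (.all φ) → Deriv Γ (inst φ k)
  | eqI {Γ : Set (Fml ℕ 0)} (k : ℕ) : Deriv Γ (varEq k k)
  | eqE {Γ : Set (Fml ℕ 0)} (φ : Fml ℕ 1) {j k : ℕ} :
      Deriv Γ (varEq j k) → Deriv Γ (inst φ j) → Deriv Γ (inst φ k)

/-- Formulas in a context of `n` variables: the free variables are among `&0, …, &(n-1)`. -/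
abbrev Frm (n : ℕ) := Fml Empty n

/-- A formula in context as a formula in the variables `v₀, v₁, …`. -/
def toVars {n : ℕ} (φ : Frm n) : Fml ℕ 0 :=
  ren φ (Sum.elim Empty.elim fun i => Sum.inl (i : ℕ))

/-- `Provable T φ` is `⊢_T φ`: the formula `φ` is derivable from axioms in `T`. -/
def Provable (T : Set (Frm 0)) {n : ℕ} (φ : Frm n) : Prop :=
  Deriv (toVars '' T) (toVars φ)

/-! ### Derivability coincides with truth in all models

This is used to verify the laws of the category of classes. -/

section Completeness

theorem liftVar_comp {α β γ : Type} {n m l : ℕ} (τ : β ⊕ Fin m → γ ⊕ Fin l)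
    (σ : α ⊕ Fin n → β ⊕ Fin m) : liftVar τ ∘ liftVar σ = liftVar (τ ∘ σ) := by
  funext x
  rcases x with a | i
  · simp only [liftVar, Function.comp, Sum.elim_inl]
    rcases σ (Sum.inl a) with b | j <;> simp
  · refine Fin.lastCases ?_ (fun i => ?_) i
    · simp [liftVar]
    · simp only [liftVar, Function.comp, Sum.elim_inr, Fin.lastCases_castSucc]
      rcases σ (Sum.inr i) with b | j <;> simp

theorem ren_ren {α β γ : Type} {n m l : ℕ} (φ : Fml α n) (σ : α ⊕ Fin n → β ⊕ Fin m)
    (τ : β ⊕ Fin m → γ ⊕ Fin l) : ren (ren φ σ) τ = ren φ (τ ∘ σ) := by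
  induction φ generalizing m l with
  | falsum => rfl
  | equal s t => simp [ren, Term.relabel_relabel]
  | rel R ts => simp [ren, Term.relabel_relabel]
  | imp φ ψ h₁ h₂ => simp [ren, h₁, h₂]
  | all φ h => simp [ren, h, liftVar_comp]

theorem realize_ren {α β M : Type} [setLang.Structure M] {n m : ℕ} (φ : Fml α n)
    (σ : α ⊕ Fin n → β ⊕ Fin m) (v : β → M) (xs : Fin m → M) :
    (ren φ σ).Realize v xs ↔ φ.Realize (fun a => Sum.elim v xs (σ (Sum.inl a)))
      (fun i => Sum.elim v xs (σ (Sum.inr i))) := by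
  have key : ∀ {k : ℕ} (σ : α ⊕ Fin k → β ⊕ Fin m) (xs : Fin m → M),
      Sum.elim (fun a => Sum.elim v xs (σ (Sum.inl a)))
        (fun i => Sum.elim v xs (σ (Sum.inr i))) = Sum.elim v xs ∘ σ := by
    intro k σ xs
    funext x
    rcases x with a | i <;> rfl
  induction φ generalizing m with
  | falsum => rfl
  | equal s t =>
    simp only [ren, BoundedFormula.Realize, Term.realize_relabel]
    rw [show Sum.elim (fun a => Sum.elim v xs (σ (Sum.inl a)))
        (fun i => Sum.elim v xs (σ (Sum.inr i))) = Sum.elim v xs ∘ σ from key σ xs]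
  | rel R ts =>
    simp only [ren, BoundedFormula.Realize, Term.realize_relabel]
    rw [show Sum.elim (fun a => Sum.elim v xs (σ (Sum.inl a)))
        (fun i => Sum.elim v xs (σ (Sum.inr i))) = Sum.elim v xs ∘ σ from key σ xs]
  | imp φ ψ h₁ h₂ => simp only [ren, BoundedFormula.Realize, h₁ _ _ key, h₂ _ _ key]
  | all φ h =>
    simp only [ren, BoundedFormula.Realize]
    refine forall_congr' fun x => ?_
    refine (h _ _ (fun σ xs => by funext x; rcases x with a | i <;> rfl)).trans (iff_of_eq ?_)
    congr 1
    · funext a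
      simp only [liftVar, Sum.elim_inl]
      rcases σ (Sum.inl a) with b | j <;> simp
    · funext i
      refine Fin.lastCases ?_ (fun i => ?_) i
      · simp [liftVar]
      · simp only [liftVar, Sum.elim_inr, Fin.lastCases_castSucc, Fin.snoc_castSucc]
        rcases σ (Sum.inr i) with b | j <;> simp

theorem realize_inst {M : Type} [setLang.Structure M] (φ : Fml ℕ 1) (k : ℕ) (v : ℕ → M)
    (xs : Fin 0 → M) : (inst φ k).Realize v xs ↔ φ.Realize v (fun _ => v k) := by
  rw [inst, realize_ren]
  rfl

theorem realize_toVars {M : Type} [setLang.Structure M] {n : ℕ} (φ : Frm n) (v : ℕ → M)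
    (xs : Fin 0 → M) : (toVars φ).Realize v xs ↔ φ.Realize Empty.elim (fun i => v i) := by
  rw [toVars, realize_ren]
  apply iff_of_eq
  congr 1
  funext a
  exact a.elim

theorem term_eq_var {α : Type} (t : setLang.Term α) : ∃ a, t = .var a := by
  cases t with
  | var a => exact ⟨a, rfl⟩
  | func f _ => exact (f : Empty).elim

theorem realize_congr {α M : Type} [DecidableEq α] [setLang.Structure M] {n : ℕ} (φ : Fml α n)
    (v w : α → M) (xs : Fin n → M) (h : ∀ a ∈ φ.freeVarFinset, v a = w a) :
    φ.Realize v xs ↔ φ.Realize w xs := by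
  have ht : ∀ {n : ℕ} (t : setLang.Term (α ⊕ Fin n)) (xs : Fin n → M),
      (∀ a ∈ t.varFinsetLeft, v a = w a) →
      t.realize (Sum.elim v xs) = t.realize (Sum.elim w xs) := by
    intro n t xs ht
    obtain ⟨a | i, rfl⟩ := term_eq_var t
    · simpa using ht a (by simp [Term.varFinsetLeft])
    · rfl
  induction φ with
  | falsum => rfl
  | equal s t =>
    simp only [BoundedFormula.freeVarFinset, Finset.mem_union] at h
    simp only [BoundedFormula.Realize]
    rw [ht s xs fun a ha => h a (Or.inl ha), ht t xs fun a ha => h a (Or.inr ha)]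
  | rel R ts =>
    simp only [BoundedFormula.freeVarFinset, Finset.mem_biUnion] at h
    simp only [BoundedFormula.Realize]
    rw [funext fun i => ht (ts i) xs fun a ha => h a ⟨i, Finset.mem_univ _, ha⟩]
  | imp φ ψ h₁ h₂ =>
    simp only [BoundedFormula.freeVarFinset, Finset.mem_union] at h
    simp only [BoundedFormula.Realize]
    exact imp_congr (h₁ xs fun a ha => h a (Or.inl ha)) (h₂ xs fun a ha => h a (Or.inr ha))
  | all φ ih =>
    simp only [BoundedFormula.Realize]
    exact forall_congr' fun x => ih _ h

theorem Deriv.sound {M : Type} [setLang.Structure M] {Γ : Set (Fml ℕ 0)} {φ : Fml ℕ 0}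
    (h : Deriv Γ φ) : ∀ v : ℕ → M, (∀ ψ ∈ Γ, ψ.Realize v default) → φ.Realize v default := by
  induction h with
  | hyp h => exact fun v hv => hv _ h
  | weaken hs _ ih => exact fun v hv => ih v fun ψ hψ => hv ψ (hs hψ)
  | impI _ ih =>
    intro v hv hφ
    refine ih v fun χ hχ => ?_
    rcases hχ with rfl | hχ
    · exact hφ
    · exact hv χ hχ
  | impE _ _ ih₁ ih₂ => exact fun v hv => ih₁ v hv (ih₂ v hv)
  | raa _ ih =>
    intro v hv
    by_contra hφ
    refine ih v fun χ hχ => ?_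
    rcases hχ with rfl | hχ
    · exact hφ
    · exact hv χ hχ
  | @allI Γ φ k hΓ hφ _ ih =>
    intro v hv x
    have := ih (Function.update v k x) fun ψ hψ => (realize_congr ψ _ v _ fun a ha =>
      Function.update_of_ne (fun e : a = k => hΓ ψ hψ (e ▸ ha)) _ _).2 (hv ψ hψ)
    rw [realize_inst, Function.update_self] at this
    have h2 := (realize_congr φ _ v _ fun a ha =>
      Function.update_of_ne (fun e : a = k => hφ (e ▸ ha)) _ _).1 this
    convert h2 using 1
    funext i
    rw [show i = Fin.last 0 from Fin.fin_one_eq_zero i, Fin.snoc_last]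
  | @allE Γ φ k _ ih =>
    intro v hv
    rw [realize_inst]
    have := ih v hv (v k)
    convert this using 1
    funext i
    rw [show i = Fin.last 0 from Fin.fin_one_eq_zero i, Fin.snoc_last]
  | eqI k => exact fun v _ => rfl
  | eqE φ _ _ ih₁ ih₂ =>
    intro v hv
    have h₁ : v _ = v _ := ih₁ v hv
    have h₂ := ih₂ v hv
    rw [realize_inst] at h₂ ⊢
    rwa [← h₁]

theorem Deriv.compact {Γ : Set (Fml ℕ 0)} {φ : Fml ℕ 0} (h : Deriv Γ φ) :
    ∃ Δ : Set (Fml ℕ 0), Δ.Finite ∧ Δ ⊆ Γ ∧ Deriv Δ φ := by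
  have key : ∀ {Γ : Set (Fml ℕ 0)} {χ ψ : Fml ℕ 0},
      (∃ Δ : Set (Fml ℕ 0), Δ.Finite ∧ Δ ⊆ insert χ Γ ∧ Deriv Δ ψ) →
      ∃ Δ : Set (Fml ℕ 0), Δ.Finite ∧ Δ ⊆ Γ ∧ Deriv (insert χ Δ) ψ := by
    rintro Γ χ ψ ⟨Δ, hf, hs, hd⟩
    refine ⟨Δ \ {χ}, hf.sdiff, fun x hx => (hs hx.1).resolve_left hx.2, hd.weaken fun x hx => ?_⟩
    by_cases hxχ : x = χ
    · exact Or.inl hxχ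
    · exact Or.inr ⟨hx, hxχ⟩
  induction h with
  | hyp h => exact ⟨{_}, Set.finite_singleton _, Set.singleton_subset_iff.2 h, .hyp rfl⟩
  | weaken hs _ ih =>
    obtain ⟨Δ, hf, hΔ, hd⟩ := ih
    exact ⟨Δ, hf, hΔ.trans hs, hd⟩
  | impI _ ih =>
    obtain ⟨Δ, hf, hΔ, hd⟩ := key ih
    exact ⟨Δ, hf, hΔ, .impI hd⟩
  | raa _ ih =>
    obtain ⟨Δ, hf, hΔ, hd⟩ := key ih
    exact ⟨Δ, hf, hΔ, .raa hd⟩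
  | impE _ _ ih₁ ih₂ =>
    obtain ⟨Δ, hf, hΔ, hd⟩ := ih₁
    obtain ⟨Δ', hf', hΔ', hd'⟩ := ih₂
    exact ⟨Δ ∪ Δ', hf.union hf', Set.union_subset hΔ hΔ',
      .impE (hd.weaken Set.subset_union_left) (hd'.weaken Set.subset_union_right)⟩
  | allI k hΓ hφ _ ih =>
    obtain ⟨Δ, hf, hΔ, hd⟩ := ih
    exact ⟨Δ, hf, hΔ, .allI k (fun ψ hψ => hΓ ψ (hΔ hψ)) hφ hd⟩
  | allE k _ ih =>
    obtain ⟨Δ, hf, hΔ, hd⟩ := ih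
    exact ⟨Δ, hf, hΔ, .allE k hd⟩
  | eqI k => exact ⟨∅, Set.finite_empty, Set.empty_subset _, .eqI k⟩
  | eqE χ _ _ ih₁ ih₂ =>
    obtain ⟨Δ, hf, hΔ, hd⟩ := ih₁
    obtain ⟨Δ', hf', hΔ', hd'⟩ := ih₂
    exact ⟨Δ ∪ Δ', hf.union hf', Set.union_subset hΔ hΔ',
      .eqE χ (hd.weaken Set.subset_union_left) (hd'.weaken Set.subset_union_right)⟩

instance : Countable (Fml ℕ 1) := by
  have : Countable (Σ l, setLang.Functions l) := ⟨⟨fun x => (x.2 : Empty).elim,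
    fun x => (x.2 : Empty).elim⟩⟩
  have : Countable (Σ l, setLang.Relations l) := by
    refine ⟨⟨fun _ => 0, ?_⟩⟩
    rintro ⟨_, ⟨⟩⟩ ⟨_, ⟨⟩⟩ _
    rfl
  have : Countable setLang.Symbols := inferInstanceAs (Countable (_ ⊕ _))
  exact Function.Injective.countable (f := fun φ : Fml ℕ 1 => (⟨1, φ⟩ : Σ n, Fml ℕ n))
    fun φ ψ h => by simpa using h

theorem ren_free {α : Type} {n m : ℕ} (φ : Fml α n) (σ : α ⊕ Fin n → ℕ ⊕ Fin m) (k : ℕ)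
    (hσ : ∀ x, σ x ≠ Sum.inl k) : k ∉ (ren φ σ).freeVarFinset := by
  have ht : ∀ {n m : ℕ} (t : setLang.Term (α ⊕ Fin n)) (σ : α ⊕ Fin n → ℕ ⊕ Fin m),
      (∀ x, σ x ≠ Sum.inl k) → k ∉ (t.relabel σ).varFinsetLeft := by
    intro n m t σ hσ
    obtain ⟨x, rfl⟩ := term_eq_var t
    have := hσ x
    simp only [Term.relabel]
    rcases h : σ x with j | j
    · rw [h] at this
      simpa [Term.varFinsetLeft, eq_comm] using this
    · simp [Term.varFinsetLeft]
  induction φ generalizing m with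
  | falsum => simp [ren, BoundedFormula.freeVarFinset]
  | equal s t => simp [ren, BoundedFormula.freeVarFinset, ht s σ hσ, ht t σ hσ]
  | rel R ts => simp [ren, BoundedFormula.freeVarFinset, ht _ σ hσ]
  | imp φ ψ h₁ h₂ => simp [ren, BoundedFormula.freeVarFinset, h₁ σ hσ, h₂ σ hσ]
  | all φ ih =>
    simp only [ren, BoundedFormula.freeVarFinset]
    refine ih _ fun x => ?_
    rcases x with a | i
    · have := hσ (Sum.inl a)
      simp only [liftVar, Sum.elim_inl]
      rcases h : σ (Sum.inl a) with j | j <;> simp_all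
    · refine Fin.lastCases ?_ (fun i => ?_) i
      · simp [liftVar]
      · have := hσ (Sum.inr i)
        simp only [liftVar, Sum.elim_inr, Fin.lastCases_castSucc]
        rcases h : σ (Sum.inr i) with j | j <;> simp_all

/-- A set of formulas is Henkin if every universal formula has a variable testing it. -/
def Henkin (Γ : Set (Fml ℕ 0)) : Prop :=
  ∀ φ : Fml ℕ 1, ∃ k : ℕ, (inst φ k).imp φ.all ∈ Γ

theorem exists_henkin (Γ : Set (Fml ℕ 0)) (hΓ : ¬ Deriv Γ .falsum)
    (hfr : ∃ s : Finset ℕ, ∀ ψ ∈ Γ, ∀ k ∈ ψ.freeVarFinset, k ∈ s) :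
    ∃ Δ, Γ ⊆ Δ ∧ ¬ Deriv Δ .falsum ∧ Henkin Δ := by
  classical
  let Good := {Δ : Set (Fml ℕ 0) // ¬ Deriv Δ .falsum ∧
    ∃ s : Finset ℕ, ∀ ψ ∈ Δ, ∀ k ∈ ψ.freeVarFinset, k ∈ s}
  have step : ∀ (Δ : Good) (φ : Fml ℕ 1), ∃ Δ' : Good, Δ.1 ⊆ Δ'.1 ∧
      ∃ k, (inst φ k).imp φ.all ∈ Δ'.1 := by
    rintro ⟨Δ, hΔ, s, hs⟩ φ
    obtain ⟨k, hk⟩ := Infinite.exists_notMem_finset (s ∪ φ.freeVarFinset)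
    rw [Finset.mem_union, not_or] at hk
    refine ⟨⟨insert ((inst φ k).imp φ.all) Δ, fun hd => hΔ ?_,
      s ∪ ((inst φ k).imp φ.all).freeVarFinset, ?_⟩, Set.subset_insert _ _, k, Or.inl rfl⟩
    · have hn : Deriv Δ (((inst φ k).imp φ.all).imp .falsum) := .impI hd
      refine .impE hn (.impI (.weaken (Set.subset_insert _ _) (.allI k (fun ψ hψ h => hk.1 (hs ψ hψ k h)) hk.2 ?_)))
      refine .raa (.impE (hn.weaken (Set.subset_insert _ _)) (.impI (.raa ?_)))
      refine .impE (φ := inst φ k) (.hyp ?_) (.hyp ?_) <;> simp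
    · intro ψ hψ j hj
      rcases hψ with rfl | hψ
      · exact Finset.mem_union_right _ hj
      · exact Finset.mem_union_left _ (hs ψ hψ j hj)
  choose next hnext hwit using step
  obtain ⟨e, he⟩ := exists_surjective_nat (Fml ℕ 1)
  let seq : ℕ → Good := fun i => Nat.rec ⟨Γ, hΓ, hfr⟩ (fun i Δ => next Δ (e i)) i
  have hmono : Monotone fun i => (seq i).1 := monotone_nat_of_le_succ fun i => hnext _ _
  refine ⟨⋃ i, (seq i).1, Set.subset_iUnion (fun i => (seq i).1) 0, fun hd => ?_, fun φ => ?_⟩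
  · obtain ⟨F, hF, hs, hd⟩ := hd.compact
    obtain ⟨i, hi⟩ := hmono.directed_le.exists_mem_subset_of_finset_subset_biUnion (s := hF.toFinset)
      (by simpa using hs)
    exact (seq i).2.1 (hd.weaken (by simpa using hi))
  · obtain ⟨i, rfl⟩ := he φ
    obtain ⟨k, hk⟩ := hwit (seq i) (e i)
    exact ⟨k, Set.mem_iUnion.2 ⟨i + 1, hk⟩⟩

theorem exists_maximal (Γ : Set (Fml ℕ 0)) (hΓ : ¬ Deriv Γ .falsum) :
    ∃ Δ, Γ ⊆ Δ ∧ Maximal (fun Δ => ¬ Deriv Δ .falsum) Δ := by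
  refine zorn_subset_nonempty {Δ | ¬ Deriv Δ .falsum} (fun c hc hch hne => ?_) Γ hΓ
  refine ⟨⋃₀ c, fun hd => ?_, fun s hs => Set.subset_sUnion_of_mem hs⟩
  obtain ⟨F, hF, hs, hd⟩ := Deriv.compact hd
  obtain ⟨t, ht, hFt⟩ := hch.directedOn.exists_mem_subset_of_finite_of_subset_sUnion hne hF hs
  exact hc ht (hd.weaken hFt)

variable {Δ : Set (Fml ℕ 0)}

theorem mem_of_deriv (hΔ : Maximal (fun Δ => ¬ Deriv Δ .falsum) Δ) {φ : Fml ℕ 0}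
    (h : Deriv Δ φ) : φ ∈ Δ := by
  have : ¬ Deriv (insert φ Δ) .falsum := fun hd => hΔ.prop (.impE (.impI hd) h)
  exact hΔ.le_of_ge this (Set.subset_insert _ _) (Set.mem_insert _ _)

theorem imp_mem_iff (hΔ : Maximal (fun Δ => ¬ Deriv Δ .falsum) Δ) {φ ψ : Fml ℕ 0} :
    φ.imp ψ ∈ Δ ↔ (φ ∈ Δ → ψ ∈ Δ) := by
  refine ⟨fun h h' => mem_of_deriv hΔ (.impE (.hyp h) (.hyp h')), fun h => ?_⟩
  by_cases hφ : φ ∈ Δ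
  · exact mem_of_deriv hΔ (.impI (.hyp (Or.inr (h hφ))))
  · refine mem_of_deriv hΔ (.impI (.raa (.weaken (Set.subset_insert _ _) ?_)))
    by_contra hc
    exact hφ (hΔ.le_of_ge hc (Set.subset_insert _ _) (Set.mem_insert _ _))

/-- Provable equality of variables, relative to `Δ`. -/
def varSetoid (hΔ : Maximal (fun Δ => ¬ Deriv Δ .falsum) Δ) : Setoid ℕ where
  r j k := varEq j k ∈ Δ
  iseqv := by
    refine ⟨fun k => mem_of_deriv hΔ (.eqI k), fun {j k} h => ?_, fun {i j k} h h' => ?_⟩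
    · exact mem_of_deriv hΔ (Deriv.eqE (.equal (.var (Sum.inr 0)) (.var (Sum.inl j)))
        (.hyp h) (.eqI j))
    · exact mem_of_deriv hΔ (Deriv.eqE (.equal (.var (Sum.inl i)) (.var (Sum.inr 0)))
        (.hyp h') (.hyp h))

/-- The term model of `Δ`. -/
def TermModel (hΔ : Maximal (fun Δ => ¬ Deriv Δ .falsum) Δ) : Type := Quotient (varSetoid hΔ)

/-- The class of a variable. -/
def TermModel.mk (hΔ : Maximal (fun Δ => ¬ Deriv Δ .falsum) Δ) (k : ℕ) : TermModel hΔ :=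
  Quotient.mk (varSetoid hΔ) k

/-- A representative. -/
noncomputable def TermModel.rep {hΔ : Maximal (fun Δ => ¬ Deriv Δ .falsum) Δ} (x : TermModel hΔ) :
    ℕ :=
  Quotient.out (s := varSetoid hΔ) x

theorem TermModel.mk_eq {hΔ : Maximal (fun Δ => ¬ Deriv Δ .falsum) Δ} {j k : ℕ} :
    mk hΔ j = mk hΔ k ↔ varEq j k ∈ Δ :=
  Quotient.eq (r := varSetoid hΔ)

noncomputable instance (hΔ : Maximal (fun Δ => ¬ Deriv Δ .falsum) Δ) :
    setLang.Structure (TermModel hΔ) where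
  funMap := fun f => (f : Empty).elim
  RelMap := fun R xs => BoundedFormula.rel R (fun i => .var (Sum.inl (xs i).rep)) ∈ Δ

theorem realize_termModel (hΔ : Maximal (fun Δ => ¬ Deriv Δ .falsum) Δ) (hH : Henkin Δ) {n : ℕ}
    (φ : Fml ℕ n) (w : Fin n → ℕ) :
    φ.Realize (M := TermModel hΔ) (TermModel.mk hΔ)
      (fun i => TermModel.mk hΔ (w i)) ↔
    ren φ (Sum.elim Sum.inl fun i => (Sum.inl (w i) : ℕ ⊕ Fin 0)) ∈ Δ := by
  have ht : ∀ {n : ℕ} (t : setLang.Term (ℕ ⊕ Fin n)) (w : Fin n → ℕ), ∃ j : ℕ,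
      t.realize (M := TermModel hΔ) (Sum.elim (TermModel.mk hΔ)
        (fun i => TermModel.mk hΔ (w i))) = TermModel.mk hΔ j ∧
      t.relabel (Sum.elim Sum.inl fun i => (Sum.inl (w i) : ℕ ⊕ Fin 0)) = .var (Sum.inl j) := by
    intro n t w
    obtain ⟨a | i, rfl⟩ := term_eq_var t
    · exact ⟨a, rfl, rfl⟩
    · exact ⟨w i, rfl, rfl⟩
  induction φ with
  | falsum => exact ⟨False.elim, fun h => hΔ.prop (.hyp h)⟩
  | equal s t =>
    obtain ⟨j, hj, hj'⟩ := ht s w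
    obtain ⟨k, hk, hk'⟩ := ht t w
    simp only [BoundedFormula.Realize, ren, hj, hk, hj', hk']
    exact TermModel.mk_eq
  | rel R ts =>
    simp only [BoundedFormula.Realize, ren]
    choose j hj hj' using fun i => ht (ts i) w
    simp only [hj, hj']
    have hr : ∀ i, varEq (TermModel.mk hΔ (j i)).rep (j i) ∈ Δ :=
      fun i => Quotient.mk_out (s := varSetoid hΔ) (j i)
    have main : ∀ a b : Fin _ → ℕ, (∀ i, varEq (a i) (b i) ∈ Δ) →
        BoundedFormula.rel R (fun i => .var (Sum.inl (a i))) ∈ Δ →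
        (BoundedFormula.rel R (fun i => .var (Sum.inl (b i))) : Fml ℕ 0) ∈ Δ := by
      cases R
      intro a b hab h
      have h₁ := Deriv.eqE (BoundedFormula.rel (L := setLang) (n := 1) MemSymbol.mem
        ![.var (Sum.inr 0), .var (Sum.inl (a 1))]) (j := a 0) (k := b 0) (.hyp (hab 0)) (.hyp (by
          convert h using 1
          simp only [inst, ren]
          congr 1
          funext i
          fin_cases i <;> rfl))
      have h₂ := Deriv.eqE (BoundedFormula.rel (L := setLang) (n := 1) MemSymbol.mem
        ![.var (Sum.inl (b 0)), .var (Sum.inr 0)]) (j := a 1) (k := b 1) (.hyp (hab 1)) (by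
          convert h₁ using 1
          simp only [inst, ren]
          congr 1
          funext i
          fin_cases i <;> rfl)
      convert mem_of_deriv hΔ h₂ using 1
      simp only [inst, ren]
      congr 1
      funext i
      fin_cases i <;> rfl
    exact ⟨main _ _ hr, main _ _ fun i => (varSetoid hΔ).symm (hr i)⟩
  | imp φ ψ h₁ h₂ =>
    simp only [BoundedFormula.Realize, ren]
    exact (imp_congr (h₁ w) (h₂ w)).trans (imp_mem_iff hΔ).symm
  | @all n φ ih =>
    have hi : ∀ k, inst (ren φ (liftVar (Sum.elim Sum.inl fun i =>
        (Sum.inl (w i) : ℕ ⊕ Fin 0)))) k =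
        ren φ (Sum.elim Sum.inl fun i => (Sum.inl (Fin.snoc (α := fun _ => ℕ) w k i) : ℕ ⊕ Fin 0)) := by
      intro k
      rw [inst, ren_ren]
      congr 1
      funext x
      rcases x with a | i
      · rfl
      · refine Fin.lastCases ?_ (fun i => ?_) i <;> simp [liftVar]
    have hs : ∀ k, (Fin.snoc (α := fun _ => TermModel hΔ)
        (fun i => TermModel.mk hΔ (w i)) (TermModel.mk hΔ k)) =
        fun i => TermModel.mk hΔ (Fin.snoc (α := fun _ => ℕ) w k i) := by
      intro k
      funext i
      refine Fin.lastCases ?_ (fun i => ?_) i <;> simp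
    simp only [BoundedFormula.Realize, ren]
    constructor
    · intro h
      obtain ⟨k, hk⟩ := hH (ren φ (liftVar (Sum.elim Sum.inl fun i =>
        (Sum.inl (w i) : ℕ ⊕ Fin 0))))
      refine (imp_mem_iff hΔ).1 hk ?_
      rw [hi]
      refine (ih _).1 ?_
      rw [← hs]
      exact h _
    · intro h x
      obtain ⟨k, rfl⟩ := Quotient.exists_rep x
      have := mem_of_deriv hΔ (Deriv.allE k (.hyp h))
      rw [hi] at this
      have h' := (ih _).2 this
      rw [← hs] at h'
      exact h'

end Completeness

/-- Soundness and completeness of the deduction system. -/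
theorem provable_iff (T : Set (Frm 0)) {n : ℕ} (φ : Frm n) :
    Provable T φ ↔ ∀ (M : Type) [setLang.Structure M] [Nonempty M],
      (∀ ψ ∈ T, ψ.Realize Empty.elim (default : Fin 0 → M)) →
      ∀ xs : Fin n → M, φ.Realize Empty.elim xs := by
  classical
  constructor
  · intro h M _ _ hT xs
    let v : ℕ → M := fun k => if hk : k < n then xs ⟨k, hk⟩ else Classical.arbitrary M
    have := h.sound v (by
      rintro _ ⟨ψ, hψ, rfl⟩
      rw [realize_toVars]
      convert hT ψ hψ)
    rw [realize_toVars] at this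
    convert this using 1
    funext i
    simp [v]
  · intro h
    by_contra hn
    have hc : ¬ Deriv (insert ((toVars φ).imp .falsum) (toVars '' T)) .falsum :=
      fun hd => hn (.raa hd)
    obtain ⟨Δ₁, h₁, hc₁, hH⟩ := exists_henkin _ hc ⟨((toVars φ).imp .falsum).freeVarFinset, by
      rintro ψ (rfl | ⟨ψ, -, rfl⟩) k hk
      · exact hk
      · refine absurd hk (ren_free _ _ _ ?_)
        rintro (x | x)
        · exact x.elim
        · exact x.elim0⟩
    obtain ⟨Δ, h₂, hΔ⟩ := exists_maximal Δ₁ hc₁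
    have hH' : Henkin Δ := fun φ => (hH φ).imp fun k hk => h₂ hk
    have : Nonempty (TermModel hΔ) := ⟨TermModel.mk hΔ 0⟩
    have key : ∀ ψ : Fml ℕ 0, ψ.Realize (M := TermModel hΔ)
        (TermModel.mk hΔ) default ↔ ψ ∈ Δ := by
      intro ψ
      have hr : ∀ {m : ℕ} (χ : Fml ℕ m), ren χ id = χ := by
        intro m χ
        have hl : ∀ m, liftVar (id : ℕ ⊕ Fin m → ℕ ⊕ Fin m) = id := by
          intro m
          funext x
          rcases x with a | i
          · rfl
          · refine Fin.lastCases ?_ (fun i => ?_) i <;> simp [liftVar]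
        induction χ with
        | falsum => rfl
        | equal s t => simp [ren]
        | rel R ts => simp [ren]
        | imp _ _ h₁ h₂ => simp [ren, h₁, h₂]
        | all _ h => simp [ren, hl, h]
      have := realize_termModel hΔ hH' ψ (fun i => i.elim0)
      rw [show (Sum.elim Sum.inl fun i : Fin 0 => (Sum.inl (i.elim0) : ℕ ⊕ Fin 0)) = id by
        funext x
        rcases x with a | i
        · rfl
        · exact i.elim0, hr] at this
      convert this using 2
    have hf := (key _).2 (h₂ (h₁ (Or.inl rfl)))
    refine hf ?_
    rw [realize_toVars]
    refine h _ (fun ψ hψ => ?_) _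
    have := (key _).2 (h₂ (h₁ (Or.inr ⟨ψ, hψ, rfl⟩)))
    rw [realize_toVars] at this
    convert this

theorem realize_empty {M : Type} [setLang.Structure M] {n : ℕ} (φ : Frm n) (v : Empty → M)
    (xs : Fin n → M) : φ.Realize v xs ↔ φ.Realize Empty.elim xs := by
  rw [Subsingleton.elim v Empty.elim]

/-! ## The axioms of ZF -/

/-- The atomic formula `&i ∈ &j`. -/
def mem {n : ℕ} (i j : Fin n) : Frm n :=
  .rel (L := setLang) MemSymbol.mem ![.var (Sum.inr i), .var (Sum.inr j)]

/-- The atomic formula `&i = &j`. -/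
def eq {n : ℕ} (i j : Fin n) : Frm n :=
  .equal (.var (Sum.inr i)) (.var (Sum.inr j))

/-- Substitution of the variable `&(f i)` for `&i`. -/
def rn {n m : ℕ} (φ : Frm n) (f : Fin n → Fin m) : Frm m :=
  ren φ (Sum.elim Empty.elim fun i => Sum.inr (f i))

/-- `∀x ∀y (∀t (t ∈ x ↔ t ∈ y) → x = y)`. -/
def axExtensionality : Frm 0 :=
  ∀' ∀' ((∀' (mem 2 0 ⇔ mem 2 1)) ⟹ eq 0 1)

/-- `∀p₁ … ∀pₖ ∀x ∃y ∀t (t ∈ y ↔ t ∈ x ∧ P(p₁, …, pₖ, t))`. -/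
def axSeparation (k : ℕ) (P : Frm (k + 1)) : Frm 0 :=
  let x : Fin (k + 3) := ⟨k, by omega⟩
  let y : Fin (k + 3) := ⟨k + 1, by omega⟩
  let t : Fin (k + 3) := ⟨k + 2, by omega⟩
  BoundedFormula.alls (n := k) <|
    ∀' ∃' ∀' (mem t y ⇔ (mem t x ⊓ rn P (Fin.snoc (Fin.castLE (by omega)) t)))

/-- `∀x ∀y ∃z ∀t (t ∈ z ↔ t = x ∨ t = y)`. -/
def axPairing : Frm 0 :=
  ∀' ∀' ∃' ∀' (mem 3 2 ⇔ (eq 3 0 ⊔ eq 3 1))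

/-- `∀x ∃z ∀t (t ∈ z ↔ ∃y (t ∈ y ∧ y ∈ x))`. -/
def axUnion : Frm 0 :=
  ∀' ∃' ∀' (mem 2 1 ⇔ ∃' (mem 2 3 ⊓ mem 3 0))

/-- `∀y ∃z ∀x (x ∈ z ↔ ∀t (t ∈ x → t ∈ y))`. -/
def axPowerset : Frm 0 :=
  ∀' ∃' ∀' (mem 2 1 ⇔ ∀' (mem 3 2 ⟹ mem 3 0))

/-- `∀p₁ … ∀pₖ ∀z (∀x (x ∈ z → ∃!y F(p₁, …, pₖ, x, y)) →
∃z' ∀x (x ∈ z → ∃y (y ∈ z' ∧ F(p₁, …, pₖ, x, y))))`, where `∃!y F(y)` is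
`∃y ∀y' (F(y') ↔ y' = y)`. -/
def axReplacement (k : ℕ) (F : Frm (k + 2)) : Frm 0 :=
  let F' : Fin (k + 4) → Fin (k + 4) → Frm (k + 4) := fun x y =>
    rn F (Fin.snoc (Fin.snoc (Fin.castLE (by omega)) x : Fin (k + 1) → Fin (k + 4)) y)
  let v : {m : ℕ} → (i : ℕ) → (h : i < m) → Fin m := fun i h => ⟨i, h⟩
  BoundedFormula.alls (n := k) <|
    ∀' ((∀' (mem (v (k + 1) (by omega)) (v k (by omega)) ⟹
          ∃' ∀' (F' (v (k + 1) (by omega)) (v (k + 3) (by omega)) ⇔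
            eq (v (k + 3) (by omega)) (v (k + 2) (by omega))))) ⟹
      ∃' ∀' (mem (v (k + 2) (by omega)) (v k (by omega)) ⟹
          ∃' (mem (v (k + 3) (by omega)) (v (k + 1) (by omega)) ⊓
            F' (v (k + 2) (by omega)) (v (k + 3) (by omega)))))

/-- `∃x (0 ∈ x ∧ ∀t (t ∈ x → t ∪ {t} ∈ x))`. -/
def axInfinity : Frm 0 :=
  ∃' ((∃' ((∀' ∼(mem 2 1)) ⊓ mem 1 0)) ⊓
    ∀' (mem 1 0 ⟹ ∃' ((∀' (mem 3 2 ⇔ (mem 3 1 ⊔ eq 3 1))) ⊓ mem 2 0)))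

/-- `∀x (x ≠ 0 → ∃z (z ∈ x ∧ ∀t (t ∈ x → t ∉ z)))`. -/
def axFoundation : Frm 0 :=
  ∀' ((∃' (mem 1 0)) ⟹ ∃' (mem 1 0 ⊓ ∀' (mem 2 0 ⟹ ∼(mem 2 1))))

/-- Zermelo–Fraenkel set theory. -/
def ZF : Set (Frm 0) :=
  {axExtensionality, axPairing, axUnion, axPowerset, axInfinity, axFoundation} ∪
    {φ | ∃ (k : ℕ) (P : Frm (k + 1)), φ = axSeparation k P} ∪
    {φ | ∃ (k : ℕ) (F : Frm (k + 2)), φ = axReplacement k F}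

/-! ## The category of definable classes -/

/-- `IsFunctional P Q F`: the formula `F(x, y)` defines, provably in ZF, a function from the class
`{x | P}` to the class `{y | Q}`. -/
structure IsFunctional (P Q : Frm 1) (F : Frm 2) : Prop where
  /-- `F(x, y) ⊢ P(x) ∧ Q(y)` -/
  dom_cod : Provable ZF (F ⟹ (rn P ![0] ⊓ rn Q ![1]))
  /-- `F(x, y) ∧ F(x, y') ⊢ y = y'` -/
  unique : Provable ZF ((rn F ![0, 1] ⊓ rn F ![0, 2]) ⟹ (eq 1 2 : Frm 3))
  /-- `P(x) ⊢ ∃y F(x, y)` -/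
  total : Provable ZF (P ⟹ ∃' F)

section Semantics

theorem snoc_one {M : Type} (x y : M) :
    (Fin.snoc (α := fun _ => M) ![x] y : Fin 2 → M) = ![x, y] := by
  funext i
  fin_cases i <;> rfl

theorem snoc_two {M : Type} (x y z : M) :
    (Fin.snoc (α := fun _ => M) ![x, y] z : Fin 3 → M) = ![x, y, z] := by
  funext i
  fin_cases i <;> rfl

variable {M : Type} [setLang.Structure M]

theorem realize_rn {n m : ℕ} (φ : Frm n) (f : Fin n → Fin m) (v : Empty → M) (xs : Fin m → M) :
    (rn φ f).Realize v xs ↔ φ.Realize Empty.elim (fun i => xs (f i)) := by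
  rw [rn, realize_ren, realize_empty]
  rfl

/-- `M` is a model of ZF. -/
def IsModel (M : Type) [setLang.Structure M] : Prop :=
  ∀ ψ ∈ ZF, ψ.Realize Empty.elim (default : Fin 0 → M)

/-- The unary relation defined by `P`. -/
def Sat₁ (P : Frm 1) (x : M) : Prop := P.Realize Empty.elim ![x]

/-- The binary relation defined by `F`. -/
def Sat₂ (F : Frm 2) (x y : M) : Prop := F.Realize Empty.elim ![x, y]

theorem realize_rn₁ {m : ℕ} (P : Frm 1) (i : Fin m) (v : Empty → M) (xs : Fin m → M) :
    (rn P ![i]).Realize v xs ↔ Sat₁ P (xs i) := by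
  rw [realize_rn, Sat₁]
  apply iff_of_eq
  congr 1
  funext j
  fin_cases j
  rfl

theorem realize_rn₂ {m : ℕ} (F : Frm 2) (i j : Fin m) (v : Empty → M) (xs : Fin m → M) :
    (rn F ![i, j]).Realize v xs ↔ Sat₂ F (xs i) (xs j) := by
  rw [realize_rn, Sat₂]
  apply iff_of_eq
  congr 1
  funext k
  fin_cases k <;> rfl

theorem realize_eq {n : ℕ} (i j : Fin n) (v : Empty → M) (xs : Fin n → M) :
    (eq i j).Realize v xs ↔ xs i = xs j := Iff.rfl

theorem provable_one_iff {φ : Frm 1} : Provable ZF φ ↔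
    ∀ (M : Type) [setLang.Structure M] [Nonempty M], IsModel M → ∀ x : M, Sat₁ φ x := by
  rw [provable_iff]
  refine forall_congr' fun M => forall_congr' fun _ => forall_congr' fun _ =>
    forall_congr' fun _ => ⟨fun h x => h _, fun h xs => ?_⟩
  convert h (xs 0) using 1
  rw [Sat₁, show xs = ![xs 0] from by funext i; fin_cases i; rfl]
  rfl

theorem provable_two_iff {φ : Frm 2} : Provable ZF φ ↔
    ∀ (M : Type) [setLang.Structure M] [Nonempty M], IsModel M → ∀ x y : M, Sat₂ φ x y := by
  rw [provable_iff]
  refine forall_congr' fun M => forall_congr' fun _ => forall_congr' fun _ =>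
    forall_congr' fun _ => ⟨fun h x y => h _, fun h xs => ?_⟩
  have := h (xs 0) (xs 1)
  rwa [Sat₂, show ![xs 0, xs 1] = xs from by funext i; fin_cases i <;> rfl] at this

theorem isFunctional_iff {P Q : Frm 1} {F : Frm 2} : IsFunctional P Q F ↔
    ∀ (M : Type) [setLang.Structure M] [Nonempty M], IsModel M →
      (∀ x y : M, Sat₂ F x y → Sat₁ P x ∧ Sat₁ Q y) ∧
      (∀ x y y' : M, Sat₂ F x y → Sat₂ F x y' → y = y') ∧
      (∀ x : M, Sat₁ P x → ∃ y, Sat₂ F x y) := by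
  have h₁ : Provable ZF (F ⟹ (rn P ![0] ⊓ rn Q ![1])) ↔
      ∀ (M : Type) [setLang.Structure M] [Nonempty M], IsModel M →
        ∀ x y : M, Sat₂ F x y → Sat₁ P x ∧ Sat₁ Q y := by
    rw [provable_two_iff]
    simp only [Sat₂, BoundedFormula.realize_imp, BoundedFormula.realize_inf, realize_rn₁]
    rfl
  have h₂ : Provable ZF ((rn F ![0, 1] ⊓ rn F ![0, 2]) ⟹ (eq 1 2 : Frm 3)) ↔
      ∀ (M : Type) [setLang.Structure M] [Nonempty M], IsModel M →
        ∀ x y y' : M, Sat₂ F x y → Sat₂ F x y' → y = y' := by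
    rw [provable_iff]
    simp only [BoundedFormula.realize_imp, BoundedFormula.realize_inf, realize_rn₂, realize_eq]
    refine forall_congr' fun M => forall_congr' fun _ => forall_congr' fun _ =>
      forall_congr' fun _ => ⟨fun h x y y' h₁ h₂ => h ![x, y, y'] ⟨h₁, h₂⟩,
        fun h xs hx => h _ _ _ hx.1 hx.2⟩
  have h₃ : Provable ZF (P ⟹ ∃' F) ↔
      ∀ (M : Type) [setLang.Structure M] [Nonempty M], IsModel M →
        ∀ x : M, Sat₁ P x → ∃ y, Sat₂ F x y := by
    rw [provable_one_iff]
    simp only [Sat₁, BoundedFormula.realize_imp, BoundedFormula.realize_ex, snoc_one]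
    rfl
  constructor
  · rintro ⟨a, b, c⟩ M _ _ hM
    exact ⟨h₁.1 a M hM, h₂.1 b M hM, h₃.1 c M hM⟩
  · intro h
    exact ⟨h₁.2 fun M _ _ hM => (h M hM).1, h₂.2 fun M _ _ hM => (h M hM).2.1,
      h₃.2 fun M _ _ hM => (h M hM).2.2⟩

theorem provable_iff_iff {F G : Frm 2} : Provable ZF (F ⇔ G) ↔
    ∀ (M : Type) [setLang.Structure M] [Nonempty M], IsModel M →
      ∀ x y : M, Sat₂ F x y ↔ Sat₂ G x y := by
  rw [provable_two_iff]
  simp only [Sat₂, BoundedFormula.realize_iff]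

end Semantics

/-- A definable class `{x | P}`. -/
structure DCL where
  /-- The formula `P`, in one variable. -/
  formula : Frm 1

namespace DCL

/-- Functional formulas from `X` to `Y`. -/
abbrev Rel (X Y : DCL) := {F : Frm 2 // IsFunctional X.formula Y.formula F}

/-- Provable equivalence: `F ≡ G` if `⊢ F ↔ G`. -/
def relSetoid (X Y : DCL) : Setoid (Rel X Y) where
  r F G := Provable ZF (F.1 ⇔ G.1)
  iseqv := by
    simp only [provable_iff_iff]
    exact ⟨fun _ _ _ _ _ _ _ => Iff.rfl, fun h M _ _ hM x y => (h M hM x y).symm,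
      fun h h' M _ _ hM x y => (h M hM x y).trans (h' M hM x y)⟩

/-- An arrow is a class `[F]` of provably equivalent functional formulas. -/
def Hom (X Y : DCL) : Type := Quotient (relSetoid X Y)

/-- `{x, x' | P(x) ∧ x = x'}`. -/
def idFrm (P : Frm 1) : Frm 2 := rn P ![0] ⊓ eq 0 1

/-- `{x, z | ∃y (F(x, y) ∧ G(y, z))}`. -/
def compFrm (F G : Frm 2) : Frm 2 := ∃' (rn F ![0, 2] ⊓ rn G ![2, 1])

theorem sat_idFrm {M : Type} [setLang.Structure M] (P : Frm 1) (x y : M) :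
    Sat₂ (idFrm P) x y ↔ Sat₁ P x ∧ x = y := by
  simp only [Sat₂, idFrm, BoundedFormula.realize_inf, realize_rn₁, realize_eq]
  rfl

theorem sat_compFrm {M : Type} [setLang.Structure M] (F G : Frm 2) (x z : M) :
    Sat₂ (compFrm F G) x z ↔ ∃ y, Sat₂ F x y ∧ Sat₂ G y z := by
  rw [Sat₂, compFrm, BoundedFormula.realize_ex]
  simp only [BoundedFormula.realize_inf, realize_rn₂, snoc_two]
  rfl

/-- The identity relation. -/
def idRel (X : DCL) : Rel X X :=
  ⟨idFrm X.formula, by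
    rw [isFunctional_iff]
    intro M _ _ _
    simp only [sat_idFrm]
    refine ⟨?_, ?_, fun x hx => ⟨x, hx, rfl⟩⟩
    · rintro x _ ⟨hx, rfl⟩
      exact ⟨hx, hx⟩
    · rintro x _ _ ⟨_, rfl⟩ ⟨_, rfl⟩
      rfl⟩

/-- The composite relation. -/
def compRel {X Y Z : DCL} (F : Rel X Y) (G : Rel Y Z) : Rel X Z :=
  ⟨compFrm F.1 G.1, by
    rw [isFunctional_iff]
    intro M _ _ hM
    obtain ⟨f₁, f₂, f₃⟩ := isFunctional_iff.1 F.2 M hM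
    obtain ⟨g₁, g₂, g₃⟩ := isFunctional_iff.1 G.2 M hM
    simp only [sat_compFrm]
    refine ⟨?_, ?_, fun x hx => ?_⟩
    · rintro x z ⟨y, h, h'⟩
      exact ⟨(f₁ _ _ h).1, (g₁ _ _ h').2⟩
    · rintro x z z' ⟨y, h, k⟩ ⟨y', h', k'⟩
      obtain rfl := f₂ _ _ _ h h'
      exact g₂ _ _ _ k k'
    · obtain ⟨y, hy⟩ := f₃ x hx
      obtain ⟨z, hz⟩ := g₃ y (f₁ _ _ hy).2
      exact ⟨z, y, hy, hz⟩⟩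

/-- Composition of arrows. -/
def Hom.comp {X Y Z : DCL} (f : Hom X Y) (g : Hom Y Z) : Hom X Z :=
  Quotient.map₂ (sa := relSetoid X Y) (sb := relSetoid Y Z) (sc := relSetoid X Z) compRel (by
    intro F F' hF G G' hG
    refine provable_iff_iff.2 fun M _ _ hM x z => ?_
    simp only [compRel, sat_compFrm]
    exact exists_congr fun y =>
      and_congr (provable_iff_iff.1 hF M hM x y) (provable_iff_iff.1 hG M hM y z)) f g

instance : Category DCL where
  Hom := Hom
  id X := Quotient.mk (relSetoid X X) (idRel X)
  comp := Hom.comp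
  id_comp := by
    rintro X Y ⟨F⟩
    refine Quotient.sound (s := relSetoid X Y) (provable_iff_iff.2 fun M _ _ hM x y => ?_)
    obtain ⟨f₁, -, -⟩ := isFunctional_iff.1 F.2 M hM
    simp only [compRel, idRel, sat_compFrm, sat_idFrm]
    exact ⟨by rintro ⟨_, ⟨_, rfl⟩, h⟩; exact h, fun h => ⟨x, ⟨(f₁ _ _ h).1, rfl⟩, h⟩⟩
  comp_id := by
    rintro X Y ⟨F⟩
    refine Quotient.sound (s := relSetoid X Y) (provable_iff_iff.2 fun M _ _ hM x y => ?_)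
    obtain ⟨f₁, -, -⟩ := isFunctional_iff.1 F.2 M hM
    simp only [compRel, idRel, sat_compFrm, sat_idFrm]
    exact ⟨by rintro ⟨_, h, _, rfl⟩; exact h, fun h => ⟨y, h, (f₁ _ _ h).2, rfl⟩⟩
  assoc := by
    rintro X Y Z W ⟨F⟩ ⟨G⟩ ⟨H⟩
    refine Quotient.sound (s := relSetoid X W) (provable_iff_iff.2 fun M _ _ hM x y => ?_)
    simp only [compRel, sat_compFrm]
    constructor
    · rintro ⟨z, ⟨w, h₁, h₂⟩, h₃⟩
      exact ⟨w, h₁, z, h₂, h₃⟩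
    · rintro ⟨w, h₁, z, h₂, h₃⟩
      exact ⟨z, ⟨w, h₁, h₂⟩, h₃⟩

/-- `∀y ∃z ∀x (F(x, y) ↔ x ∈ z)`. -/
def fibresAreSets (F : Frm 2) : Frm 0 :=
  ∀' ∃' ∀' (rn F ![2, 0] ⇔ mem 2 1)

/-- The class `S`: an arrow `[F]` is small if `⊢ ∀y ∃z ∀x (F(x, y) ↔ x ∈ z)`. -/
def smallMaps : MorphismProperty DCL := fun X Y f =>
  Quotient.lift (s := relSetoid X Y) (fun F => Provable ZF (fibresAreSets F.1)) (by
    intro F G hFG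
    simp only [provable_iff, fibresAreSets, BoundedFormula.realize_all, BoundedFormula.realize_ex,
      BoundedFormula.realize_iff, realize_rn₂]
    refine propext (forall_congr' fun M => forall_congr' fun _ => forall_congr' fun _ =>
      forall_congr' fun hM => forall_congr' fun xs => forall_congr' fun y =>
      exists_congr fun z => forall_congr' fun x => ?_)
    rw [provable_iff_iff.1 hFG M hM]) f

/-- The class `{x | P}` is a definable set if `⊢ ∃z ∀x (x ∈ z ↔ P(x))`. -/
def IsDefinableSet (X : DCL) : Prop :=
  Provable ZF (∃' ∀' (mem 1 0 ⇔ rn X.formula ![1]) : Frm 0)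

end DCL

/-! ## Classes of small maps -/

section SmallMaps

variable {C : Type*} [Category C] [HasBinaryProducts C]

/-- `e : E ⟶ X × P` is the membership relation of a power object `P` of `X` for `S`: the universal
relation `R ↣ X × Z` whose second component is in `S`. -/
structure IsPowerObject (S : MorphismProperty C) {X P E : C} (e : E ⟶ X ⨯ P) : Prop where
  mono : Mono e
  small : S (e ≫ prod.snd)
  existsUnique_pullback {Z R : C} (ψ : R ⟶ X ⨯ Z) : Mono ψ → S (ψ ≫ prod.snd) →
    ∃! ρ : Z ⟶ P, ∃ t : R ⟶ E, IsPullback t ψ e (prod.map (𝟙 X) ρ)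

/-- `s : Q ⟶ P × P` is the inclusion relation associated with `e : E ⟶ X × P`. -/
structure IsInclusion {X P E Q : C} (e : E ⟶ X ⨯ P) (s : Q ⟶ P ⨯ P) : Prop where
  mono : Mono s
  factors_iff {Z A B : C} (f₁ f₂ : Z ⟶ P) (a : A ⟶ E) (π : A ⟶ X ⨯ Z) (b : B ⟶ E)
    (π' : B ⟶ X ⨯ Z) : IsPullback a π e (prod.map (𝟙 X) f₁) →
    IsPullback b π' e (prod.map (𝟙 X) f₂) →
    ((∃ g : Z ⟶ Q, g ≫ s = prod.lift f₁ f₂) ↔ ∃ k : A ⟶ B, k ≫ π' = π)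

end SmallMaps

/-- `S` is a class of small maps in the regular category `C`. -/
structure IsClassOfSmallMaps {C : Type*} [Category C] [Regular C] (S : MorphismProperty C) :
    Prop where
  comp {X Y Z : C} (f : X ⟶ Y) (g : Y ⟶ Z) : S f → S g → S (f ≫ g)
  mono {X Y : C} (f : X ⟶ Y) : Mono f → S f
  stability {X' X Y' Y : C} {p : X' ⟶ X} {f' : X' ⟶ Y'} {f : X ⟶ Y} {q : Y' ⟶ Y} :
    IsPullback p f' f q → S f → S f'
  representability (X : C) : ∃ (P E : C) (e : E ⟶ X ⨯ P), IsPowerObject S e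
  powerset {X P E : C} (e : E ⟶ X ⨯ P) : IsPowerObject S e →
    ∃ (Q : C) (s : Q ⟶ P ⨯ P), IsInclusion e s ∧ S (s ≫ prod.snd)

end ZFClasses

/-! By soundness and completeness (`provable_iff`), being provable in ZF means being true in every
model, so every claim about formulas is checked inside one model `M` at a time. An arrow `f` acts as
a function `app f` between the members of two classes in `M`. Arrows with the same action in all
models are equal (`hom_ext`), and a formula that is functional in all models defines an arrow
(`exists_hom`). Thus `DCL` behaves like a category of sets in which only definable constructions are
allowed.

Kuratowski pairs make each definable relation the class of its pairs (`exists_tabulation`). This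
yields pullbacks, images and subobjects of products, and categorical notions become elementwise:
`isPullback_iff`, `mono_iff` (injective), `isRegularEpi_iff` (surjective), `smallMaps_iff` (each
fibre is a set of the model). Regularity then reduces to elementary facts about surjections.

The small-map axioms become set theory in `M`. Composition is union plus replacement
(`IsSet.biUnion`). Monomorphisms have fibres with at most one element. Stability is replacement
(`IsSet.image`). The power object of `X` is the class of sets contained in `X`, where extensionality
makes classifying arrows unique. The inclusion relation is small by the powerset axiom; since it is
required for an arbitrary power object, each one is first embedded in the class of subsets
(`IsPowerObject.exists_mono`). -/

namespace ZFClasses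

/-! ## Sets in models of ZF -/

section Models

/-- The ternary relation defined by `F`. -/
def Sat₃ {M : Type} [setLang.Structure M] (F : Frm 3) (x y z : M) : Prop :=
  F.Realize Empty.elim ![x, y, z]

/-- The membership relation of a structure. -/
def IsMem {M : Type} [setLang.Structure M] (x y : M) : Prop :=
  Structure.RelMap (L := setLang) (M := M) MemSymbol.mem ![x, y]

local infix:50 " ε " => IsMem

section Realize

variable {M : Type} [setLang.Structure M]

theorem realize_mem {n : ℕ} (i j : Fin n) (v : Empty → M) (xs : Fin n → M) :
    (mem i j).Realize v xs ↔ xs i ε xs j := by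
  apply iff_of_eq
  simp only [mem, IsMem, BoundedFormula.Realize]
  congr 1
  funext k
  fin_cases k <;> rfl

theorem realize_rn₃ {m : ℕ} (F : Frm 3) (i j k : Fin m) (v : Empty → M) (xs : Fin m → M) :
    (rn F ![i, j, k]).Realize v xs ↔ Sat₃ F (xs i) (xs j) (xs k) := by
  rw [realize_rn, Sat₃]
  apply iff_of_eq
  congr 1
  funext k
  fin_cases k <;> rfl

theorem realize_alls {n : ℕ} (φ : Frm n) (v : Empty → M) (xs : Fin 0 → M) :
    BoundedFormula.Realize (BoundedFormula.alls φ) v xs ↔ ∀ ys : Fin n → M, φ.Realize v ys := by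
  rw [Subsingleton.elim xs default]
  exact BoundedFormula.realize_alls

end Realize

section Snoc

variable {M : Type}

theorem snoc_zero (p : Fin 0 → M) (x : M) :
    (Fin.snoc (α := fun _ => M) p x : Fin 1 → M) = ![x] := by
  funext i
  fin_cases i
  rfl

theorem snoc_three (x y z w : M) :
    (Fin.snoc (α := fun _ => M) ![x, y, z] w : Fin 4 → M) = ![x, y, z, w] := by
  funext i
  fin_cases i <;> rfl

theorem snoc_four (x y z w u : M) :
    (Fin.snoc (α := fun _ => M) ![x, y, z, w] u : Fin 5 → M) = ![x, y, z, w, u] := by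
  funext i
  fin_cases i <;> rfl

end Snoc

/-- A model of ZF, bundled. -/
structure ZFModel where
  /-- The elements of the model. -/
  carrier : Type
  [str : setLang.Structure carrier]
  [nonempty : Nonempty carrier]
  isModel : IsModel carrier

/-! ### Set existence inside a single model. -/

namespace ZFModel

instance : CoeSort ZFModel Type := ⟨carrier⟩

attribute [instance] str nonempty

variable {M : ZFModel}

theorem ext_mem {x y : M} (h : ∀ t : M, t ε x ↔ t ε y) : x = y := by
  have := M.isModel axExtensionality (by simp [ZF])
  simp only [axExtensionality, BoundedFormula.realize_all, BoundedFormula.realize_imp,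
    BoundedFormula.realize_iff, realize_mem, realize_eq, snoc_zero, snoc_one, snoc_two] at this
  exact this x y h

/-- The extension of `p` is a set of the model. -/
def IsSet (p : M → Prop) : Prop := ∃ z : M, ∀ x : M, p x ↔ x ε z

theorem IsSet.congr {p q : M → Prop} (hp : IsSet p) (h : ∀ x, p x ↔ q x) : IsSet q := by
  rwa [← show p = q from funext fun x => propext (h x)]

theorem isSet_mem (a : M) : IsSet (fun x => x ε a) := ⟨a, fun _ => Iff.rfl⟩

theorem isSet_pair (a b : M) : IsSet (fun x => x = a ∨ x = b) := by
  have := M.isModel axPairing (by simp [ZF])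
  simp only [axPairing, BoundedFormula.realize_all, BoundedFormula.realize_ex,
    BoundedFormula.realize_sup, BoundedFormula.realize_iff, realize_mem, realize_eq, snoc_zero,
    snoc_one, snoc_two, snoc_three] at this
  obtain ⟨z, hz⟩ := this a b
  exact ⟨z, fun x => (hz x).symm⟩

theorem isSet_sUnion (a : M) : IsSet (fun x => ∃ y, x ε y ∧ y ε a) := by
  have := M.isModel axUnion (by simp [ZF])
  simp only [axUnion, BoundedFormula.realize_all, BoundedFormula.realize_ex,
    BoundedFormula.realize_inf, BoundedFormula.realize_iff, realize_mem, snoc_zero,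
    snoc_one, snoc_two, snoc_three] at this
  obtain ⟨z, hz⟩ := this a
  exact ⟨z, fun x => (hz x).symm⟩

theorem isSet_powerset (a : M) : IsSet (fun x => ∀ t, t ε x → t ε a) := by
  have := M.isModel axPowerset (by simp [ZF])
  simp only [axPowerset, BoundedFormula.realize_all, BoundedFormula.realize_ex,
    BoundedFormula.realize_imp, BoundedFormula.realize_iff, realize_mem, snoc_zero,
    snoc_one, snoc_two, snoc_three] at this
  obtain ⟨z, hz⟩ := this a
  exact ⟨z, fun x => (hz x).symm⟩

theorem IsSet.sep {q : M → Prop} (hq : IsSet q) {k : ℕ} (P : Frm (k + 1)) (c : Fin k → M) :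
    IsSet (fun x => q x ∧ P.Realize Empty.elim (Fin.snoc c x)) := by
  obtain ⟨a, ha⟩ := hq
  have := M.isModel (axSeparation k P) (by simp only [ZF]; exact Or.inl (Or.inr ⟨k, P, rfl⟩))
  simp only [axSeparation, realize_alls, BoundedFormula.realize_all,
    BoundedFormula.realize_ex, BoundedFormula.realize_inf, BoundedFormula.realize_iff,
    realize_mem, realize_rn] at this
  obtain ⟨z, hz⟩ := this c a
  refine ⟨z, fun x => ?_⟩
  -- In the axiom, positions `k` and `k + 1` hold the ambient set and the set being formed; `P`
  -- skips both and reads the parameters and position `k + 2`.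
  have hP : (fun i => (Fin.snoc (Fin.snoc (Fin.snoc c a) z) x : Fin (k + 3) → M)
      ((Fin.snoc (Fin.castLE (by omega)) ⟨k + 2, by omega⟩ : Fin (k + 1) → Fin (k + 3)) i)) =
      (Fin.snoc c x : Fin (k + 1) → M) := by
    funext i
    refine Fin.lastCases ?_ (fun i => ?_) i
    · simp [Fin.snoc]
    · simp [Fin.snoc, Nat.lt_succ_of_lt i.2, Nat.lt_succ_of_lt (Nat.lt_succ_of_lt i.2)]
      rfl
  have hx := hz x
  rw [hP] at hx
  simp only [ha]
  simpa [Fin.snoc] using hx.symm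

/-- Replacement for relations in which one parameter occurs. -/
theorem exists_collection (F : Frm 3) (c a : M) (h : ∀ x, x ε a → ∃! y, Sat₃ F c x y) :
    ∃ b : M, ∀ x, x ε a → ∃ y, y ε b ∧ Sat₃ F c x y := by
  have := M.isModel (axReplacement 1 F) (Or.inr ⟨1, F, rfl⟩)
  simp only [axReplacement, realize_alls, BoundedFormula.realize_all,
    BoundedFormula.realize_ex, BoundedFormula.realize_inf, BoundedFormula.realize_iff,
    BoundedFormula.realize_imp, realize_mem, realize_eq, realize_rn] at this
  have := this ![c] a
  simp only [snoc_one, snoc_two, snoc_three, snoc_four] at this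
  obtain ⟨b, hb⟩ := this fun x hx => by
    obtain ⟨y, hy, hu⟩ := h x hx
    refine ⟨y, fun y' => ?_⟩
    -- The context is parameter, domain, argument, value, competing value; `F` reads positions 0, 2
    -- and 4.
    have e : (fun i => ![c, a, x, y, y'] ((Fin.snoc (Fin.snoc (Fin.castLE (by omega))
        ⟨1 + 1, by omega⟩ : Fin 2 → Fin 5) ⟨1 + 3, by omega⟩ : Fin 3 → Fin 5) i)) =
        ![c, x, y'] := by
      funext i
      fin_cases i <;> rfl
    rw [e]
    exact ⟨fun h => hu _ h, fun h => (show y' = y from h) ▸ hy⟩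
  refine ⟨b, fun x hx => ?_⟩
  obtain ⟨y, hy, hF⟩ := hb x hx
  refine ⟨y, hy, ?_⟩
  rw [Sat₃]
  convert hF using 1
  funext i
  fin_cases i <;> rfl

/-- A model is nonempty, so there is some set from which to separate by `⊥`. -/
theorem isSet_empty : IsSet (fun _ : M => False) := by
  refine ((isSet_mem (Classical.arbitrary M)).sep (k := 0) ⊥ default).congr fun x => ?_
  simp

theorem isSet_of_subsingleton {p : M → Prop} (h : ∀ x y, p x → p y → x = y) : IsSet p := by
  by_cases hp : ∃ x, p x
  · obtain ⟨x, hx⟩ := hp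
    refine (isSet_pair x x).congr fun y => ?_
    rw [or_self]
    exact ⟨fun e => e ▸ hx, fun hy => h y x hy hx⟩
  · exact isSet_empty.congr fun x => ⟨False.elim, fun hx => hp ⟨x, hx⟩⟩

/-- The image of a set under a definable partial function is a set. -/
theorem IsSet.image {p : M → Prop} (hp : IsSet p) (F : Frm 3) (c : M)
    (h : ∀ x y y', p x → Sat₃ F c x y → Sat₃ F c x y' → y = y') :
    IsSet (fun y => ∃ x, p x ∧ Sat₃ F c x y) := by
  -- Replacement demands a total relation, so `p` is first cut down to the domain of `F`.
  obtain ⟨d, hd⟩ := hp.sep (k := 1) (∃' F) ![c]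
  simp only [snoc_one, BoundedFormula.realize_ex, snoc_two] at hd
  obtain ⟨b, hb⟩ := exists_collection F c d fun x hx => by
    obtain ⟨hx, y, hy⟩ := (hd x).2 hx
    exact ⟨y, hy, fun y' hy' => h x y' y hx hy' hy⟩
  -- The set `b` only contains the image; separation, with `c` and `d` as parameters, removes the
  -- surplus.
  refine ((isSet_mem b).sep (k := 2) (∃' (mem 3 1 ⊓ rn F ![0, 3, 2])) ![c, d]).congr fun y => ?_
  simp only [snoc_two, BoundedFormula.realize_ex, snoc_three, BoundedFormula.realize_inf,
    realize_mem, realize_rn₃]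
  constructor
  · rintro ⟨-, x, hx, hF⟩
    exact ⟨x, ((hd x).2 hx).1, hF⟩
  · rintro ⟨x, hx, hF⟩
    have hxd : x ε d := (hd x).1 ⟨hx, y, hF⟩
    obtain ⟨y', hy', hF'⟩ := hb x hxd
    obtain rfl := h x y y' hx hF hF'
    exact ⟨hy', x, hxd, hF⟩

/-- A union of sets, definably indexed by a set, is a set. -/
theorem IsSet.biUnion {p : M → Prop} (hp : IsSet p) (F : Frm 2)
    (h : ∀ y, p y → IsSet (fun x => Sat₂ F x y)) :
    IsSet (fun x => ∃ y, p y ∧ Sat₂ F x y) := by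
  -- The formula says that `&2` is the set of all `t` with `F(t, &1)`. So `b` is the set of all the
  -- sets in the family, to which the union axiom applies. The parameter slot `&0` is not read,
  -- hence the arbitrary filler.
  obtain ⟨b, hb⟩ := hp.image (∀' (mem 3 2 ⇔ rn F ![3, 1])) (Classical.arbitrary M) (by
    intro x y y' _ hy hy'
    simp only [Sat₃, BoundedFormula.realize_all, BoundedFormula.realize_iff, snoc_three,
      realize_mem, realize_rn₂] at hy hy'
    exact ext_mem fun t => (hy t).trans (hy' t).symm)
  simp only [Sat₃, BoundedFormula.realize_all, BoundedFormula.realize_iff, snoc_three,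
    realize_mem, realize_rn₂] at hb
  refine (isSet_sUnion b).congr fun x => ?_
  constructor
  · rintro ⟨z, hx, hz⟩
    obtain ⟨y, hy, hF⟩ := (hb z).2 hz
    exact ⟨y, hy, (hF x).1 hx⟩
  · rintro ⟨y, hy, hF⟩
    obtain ⟨z, hz⟩ := h y hy
    exact ⟨z, (hz x).1 hF, (hb z).1 ⟨y, hy, fun t => (hz t).symm⟩⟩

/-! ### Kuratowski pairs. -/

/-- `w` is the Kuratowski pair `(x, y)`. -/
def IsPair (w x y : M) : Prop :=
  ∀ t, t ε w ↔ (∀ s, s ε t ↔ s = x) ∨ ∀ s, s ε t ↔ (s = x ∨ s = y)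

theorem IsPair.unique {w w' x y : M} (h : IsPair w x y) (h' : IsPair w' x y) : w = w' :=
  ext_mem fun t => (h t).trans (h' t).symm

theorem exists_isPair (x y : M) : ∃ w, IsPair w x y := by
  obtain ⟨a, ha⟩ := isSet_pair x x
  obtain ⟨b, hb⟩ := isSet_pair x y
  obtain ⟨w, hw⟩ := isSet_pair a b
  simp only [or_self] at ha
  refine ⟨w, fun t => (hw t).symm.trans (or_congr ⟨?_, fun h => ?_⟩ ⟨?_, fun h => ?_⟩)⟩
  · rintro rfl
    exact fun s => (ha s).symm
  · exact ext_mem fun s => (h s).trans (ha s)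
  · rintro rfl
    exact fun s => (hb s).symm
  · exact ext_mem fun s => (h s).trans (hb s)

theorem IsPair.inj {w x y x' y' : M} (h : IsPair w x y) (h' : IsPair w x' y') :
    x = x' ∧ y = y' := by
  obtain ⟨a, ha⟩ := isSet_pair x x
  obtain ⟨b, hb⟩ := isSet_pair x y
  obtain ⟨b', hb'⟩ := isSet_pair x' y'
  simp only [or_self] at ha
  -- The sets `{x}` and `{x, y}` must occur among the two elements of `(x', y')`, and `{x', y'}`
  -- among those of `(x, y)`; what remains is a case analysis.
  have haw := (h' a).1 ((h a).2 (Or.inl fun s => (ha s).symm))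
  have hbw := (h' b).1 ((h b).2 (Or.inr fun s => (hb s).symm))
  have hbw' := (h b').1 ((h' b').2 (Or.inr fun s => (hb' s).symm))
  simp only [← ha, ← hb, ← hb'] at haw hbw hbw'
  have hx : x = x' := by
    rcases haw with h | h
    · exact (h x).1 rfl
    · exact ((h x').2 (Or.inl rfl)).symm
  subst hx
  refine ⟨rfl, ?_⟩
  rcases hbw with h | h
  · have hy := (h y).1 (Or.inr rfl)
    rcases hbw' with h | h
    · exact hy.trans ((h y').1 (Or.inr rfl)).symm
    · rcases (h y').1 (Or.inr rfl) with e | e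
      · exact hy.trans e.symm
      · exact e.symm
  · rcases (h y).1 (Or.inr rfl) with e | e
    · rcases (h y').2 (Or.inr rfl) with e' | e'
      · exact e.trans e'.symm
      · exact e'.symm
    · exact e

/-- The formula `&0 = (&1, &2)`. -/
def pairFrm : Frm 3 :=
  ∀' (mem 3 0 ⇔ ((∀' (mem 4 3 ⇔ eq 4 1)) ⊔ ∀' (mem 4 3 ⇔ (eq 4 1 ⊔ eq 4 2))))

theorem sat_pairFrm (w x y : M) : Sat₃ pairFrm w x y ↔ IsPair w x y := by
  simp only [Sat₃, pairFrm, BoundedFormula.realize_all, BoundedFormula.realize_iff,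
    BoundedFormula.realize_sup, snoc_three, snoc_four, realize_mem, realize_eq]
  rfl

end ZFModel

end Models

/-! ## Evaluation of classes and arrows in models -/

namespace DCL

/-- The members of a class in a model. -/
abbrev Elem (X : DCL) (M : ZFModel) : Type := {x : M // Sat₁ X.formula x}

/-- A formula representing an arrow. -/
noncomputable def graph {X Y : DCL} (f : X ⟶ Y) : Frm 2 :=
  (Quotient.out (s := relSetoid X Y) f).1

variable {X Y Z : DCL}

theorem exists_app (f : X ⟶ Y) (M : ZFModel) (x : X.Elem M) :
    ∃ y : Y.Elem M, Sat₂ (graph f) x.1 y.1 := by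
  obtain ⟨h₁, -, h₃⟩ := isFunctional_iff.1 (Quotient.out (s := relSetoid X Y) f).2 M M.isModel
  obtain ⟨y, hy⟩ := h₃ x.1 x.2
  exact ⟨⟨y, (h₁ _ _ hy).2⟩, hy⟩

/-- The function given by an arrow in a model. -/
noncomputable def app (f : X ⟶ Y) {M : ZFModel} (x : X.Elem M) : Y.Elem M :=
  (exists_app f M x).choose

variable {M : ZFModel}

theorem app_eq_iff {f : X ⟶ Y} {x : X.Elem M} {y : Y.Elem M} :
    app f x = y ↔ Sat₂ (graph f) x.1 y.1 := by
  obtain ⟨-, h₂, -⟩ := isFunctional_iff.1 (Quotient.out (s := relSetoid X Y) f).2 M M.isModel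
  have h := (exists_app f M x).choose_spec
  exact ⟨fun e => e ▸ h, fun h' => Subtype.ext (h₂ _ _ _ h h')⟩

/-- `IsFunctional` confines the graph to members of the two classes, so a quantifier over the whole
model can be replaced by one over members. -/
theorem sat_graph {f : X ⟶ Y} {x y : M} :
    Sat₂ (graph f) x y ↔ ∃ a : X.Elem M, a.1 = x ∧ (app f a).1 = y := by
  constructor
  · intro h
    obtain ⟨h₁, -, -⟩ := isFunctional_iff.1 (Quotient.out (s := relSetoid X Y) f).2 M M.isModel
    obtain ⟨hx, hy⟩ := h₁ _ _ h
    exact ⟨⟨x, hx⟩, rfl, congrArg Subtype.val (app_eq_iff (y := ⟨y, hy⟩).2 h)⟩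
  · rintro ⟨a, rfl, rfl⟩
    exact app_eq_iff.1 rfl

theorem sat_graph_left {f : X ⟶ Y} {a : X.Elem M} {y : M} :
    Sat₂ (graph f) a.1 y ↔ (app f a).1 = y := by
  rw [sat_graph]
  exact ⟨by rintro ⟨b, hb, h⟩; rwa [← Subtype.ext hb], fun h => ⟨a, rfl, h⟩⟩

theorem graph_mk (F : Rel X Y) (x y : M) :
    Sat₂ (graph (Quotient.mk (relSetoid X Y) F : X ⟶ Y)) x y ↔ Sat₂ F.1 x y :=
  provable_iff_iff.1 (Quotient.mk_out (s := relSetoid X Y) F) M M.isModel x y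

@[simp]
theorem app_id (x : X.Elem M) : app (𝟙 X) x = x := by
  rw [app_eq_iff]
  exact (graph_mk (idRel X) _ _).2 ((sat_idFrm _ _ _).2 ⟨x.2, rfl⟩)

@[simp]
theorem app_comp (f : X ⟶ Y) (g : Y ⟶ Z) (x : X.Elem M) : app (f ≫ g) x = app g (app f x) := by
  rw [app_eq_iff]
  have e : f ≫ g = Quotient.mk (relSetoid X Z)
      (compRel (Quotient.out (s := relSetoid X Y) f) (Quotient.out (s := relSetoid Y Z) g)) := by
    conv_lhs => rw [← Quotient.out_eq (s := relSetoid X Y) f,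
      ← Quotient.out_eq (s := relSetoid Y Z) g]
    rfl
  rw [e, graph_mk]
  exact (sat_compFrm _ _ _ _).2 ⟨(app f x).1, app_eq_iff.1 rfl, app_eq_iff.1 rfl⟩

/-- Completeness enters here: graphs that agree in every model are provably equivalent, hence
represent the same arrow. -/
theorem hom_ext {f g : X ⟶ Y} (h : ∀ (M : ZFModel) (x : X.Elem M), app f x = app g x) :
    f = g := by
  rw [← Quotient.out_eq (s := relSetoid X Y) f, ← Quotient.out_eq (s := relSetoid X Y) g]
  refine Quotient.sound (s := relSetoid X Y) (provable_iff_iff.2 fun N _ _ hN x y => ?_)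
  refine (sat_graph (M := ⟨N, hN⟩)).trans ?_
  simp only [h]
  exact (sat_graph (M := ⟨N, hN⟩)).symm

theorem app_eq_of_eq {f g : X ⟶ Y} (h : f = g) (x : X.Elem M) : app f x = app g x := by rw [h]

/-! ### Arrows and classes built from formulas. -/

/-- A formula that is functional between two classes defines an arrow. -/
theorem exists_hom (X Y : DCL) (F : Frm 2)
    (h : ∀ (M : ZFModel) (x : X.Elem M), ∃! y : Y.Elem M, Sat₂ F x.1 y.1) :
    ∃ f : X ⟶ Y, ∀ (M : ZFModel) (x : X.Elem M), Sat₂ F x.1 (app f x).1 := by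
  -- `F` is only controlled on members, so membership in `X` and `Y` is added to it to meet the
  -- clause `dom_cod`.
  have hs : ∀ (N : Type) [setLang.Structure N] (x y : N),
      Sat₂ (F ⊓ (rn X.formula ![0] ⊓ rn Y.formula ![1])) x y ↔
        Sat₂ F x y ∧ Sat₁ X.formula x ∧ Sat₁ Y.formula y := by
    intro N _ x y
    simp only [Sat₂, BoundedFormula.realize_inf, realize_rn₁]
    rfl
  let R : Rel X Y := ⟨F ⊓ (rn X.formula ![0] ⊓ rn Y.formula ![1]), by
    rw [isFunctional_iff]
    intro N _ _ hN
    simp only [hs]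
    refine ⟨fun x y h => h.2, fun x y y' hy hy' => ?_, fun x hx => ?_⟩
    · exact congrArg Subtype.val ((h ⟨N, hN⟩ ⟨x, hy.2.1⟩).unique (y₁ := ⟨y, hy.2.2⟩)
        (y₂ := ⟨y', hy'.2.2⟩) hy.1 hy'.1)
    · obtain ⟨y, hy, -⟩ := h ⟨N, hN⟩ ⟨x, hx⟩
      exact ⟨y.1, hy, hx, y.2⟩⟩
  refine ⟨Quotient.mk (relSetoid X Y) R, fun M x => ?_⟩
  exact ((hs M _ _).1 ((graph_mk R _ _).1 (app_eq_iff.1 rfl))).1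

/-- Every definable relation between two classes is tabulated by a class of pairs. -/
theorem exists_tabulation (X Y : DCL) (R : Frm 2) :
    ∃ (W : DCL) (p : W ⟶ X) (q : W ⟶ Y), ∀ M : ZFModel,
      (∀ w w' : W.Elem M, app p w = app p w' → app q w = app q w' → w = w') ∧
      ∀ (x : X.Elem M) (y : Y.Elem M),
        Sat₂ R x.1 y.1 ↔ ∃ w : W.Elem M, app p w = x ∧ app q w = y := by
  let W : DCL := ⟨∃' ∃' (rn ZFModel.pairFrm ![0, 1, 2] ⊓
    (rn X.formula ![1] ⊓ (rn Y.formula ![2] ⊓ rn R ![1, 2])))⟩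
  have hW : ∀ (M : ZFModel) (w : M), Sat₁ W.formula w ↔ ∃ x y, ZFModel.IsPair w x y ∧
      Sat₁ X.formula x ∧ Sat₁ Y.formula y ∧ Sat₂ R x y := by
    intro M w
    simp only [Sat₁, W, BoundedFormula.realize_ex, BoundedFormula.realize_inf, snoc_one, snoc_two,
      realize_rn₃, realize_rn₂, realize_rn₁, ZFModel.sat_pairFrm]
    rfl
  obtain ⟨p, hp⟩ := exists_hom W X (∃' rn ZFModel.pairFrm ![0, 1, 2]) fun M w => by
    obtain ⟨x, y, h, hx, hy, hR⟩ := (hW M _).1 w.2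
    simp only [Sat₂, BoundedFormula.realize_ex, snoc_two, realize_rn₃, ZFModel.sat_pairFrm]
    refine ⟨⟨x, hx⟩, ⟨y, h⟩, ?_⟩
    rintro ⟨x', hx'⟩ ⟨y', h'⟩
    exact Subtype.ext (h'.inj h).1
  obtain ⟨q, hq⟩ := exists_hom W Y (∃' rn ZFModel.pairFrm ![0, 2, 1]) fun M w => by
    obtain ⟨x, y, h, hx, hy, hR⟩ := (hW M _).1 w.2
    simp only [Sat₂, BoundedFormula.realize_ex, snoc_two, realize_rn₃, ZFModel.sat_pairFrm]
    refine ⟨⟨y, hy⟩, ⟨x, h⟩, ?_⟩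
    rintro ⟨x', hx'⟩ ⟨y', h'⟩
    exact Subtype.ext (h'.inj h).2
  simp only [Sat₂, BoundedFormula.realize_ex, snoc_two, realize_rn₃, ZFModel.sat_pairFrm] at hp hq
  -- Each projection was defined with the other coordinate quantified away; injectivity of pairing
  -- recombines the two coordinates.
  have hpq : ∀ (M : ZFModel) (w : W.Elem M), ZFModel.IsPair w.1 (app p w).1 (app q w).1 := by
    intro M w
    obtain ⟨y, hy : ZFModel.IsPair w.1 (app p w).1 y⟩ := hp M w
    obtain ⟨x, hx : ZFModel.IsPair w.1 x (app q w).1⟩ := hq M w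
    rwa [(hy.inj hx).2] at hy
  refine ⟨W, p, q, fun M => ⟨fun w w' h₁ h₂ => ?_, fun x y => ⟨fun hR => ?_, ?_⟩⟩⟩
  · have := hpq M w
    rw [h₁, h₂] at this
    exact Subtype.ext (this.unique (hpq M w'))
  · obtain ⟨w, hw⟩ := ZFModel.exists_isPair x.1 y.1
    let w' : W.Elem M := ⟨w, (hW M w).2 ⟨x.1, y.1, hw, x.2, y.2, hR⟩⟩
    have := hw.inj (hpq M w')
    refine ⟨w', ?_⟩
    exact ⟨Subtype.ext this.1.symm, Subtype.ext this.2.symm⟩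
  · rintro ⟨w, rfl, rfl⟩
    obtain ⟨x, y, h, -, -, hR⟩ := (hW M _).1 w.2
    obtain ⟨rfl, rfl⟩ := h.inj (hpq M w)
    exact hR

/-! ### Limits -/

theorem exists_terminal : ∃ T : DCL, Nonempty (IsTerminal T) ∧
    ∀ M : ZFModel, Nonempty (Unique (T.Elem M)) := by
  -- The class whose only member is the empty set.
  let T : DCL := ⟨∀' ∼(mem 1 0)⟩
  have hT : ∀ (M : ZFModel) (x : M), Sat₁ T.formula x ↔ ∀ t, ¬ IsMem t x := by
    intro M x
    simp only [Sat₁, T, BoundedFormula.realize_all, BoundedFormula.realize_not, snoc_one,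
      realize_mem]
    rfl
  have hU : ∀ (M : ZFModel), ∃ x : T.Elem M, ∀ y, y = x := by
    intro M
    obtain ⟨e, he⟩ := ZFModel.isSet_empty (M := M)
    refine ⟨⟨e, (hT M e).2 fun t ht => (he t).2 ht⟩, fun y => Subtype.ext ?_⟩
    exact ZFModel.ext_mem fun t => ⟨fun ht => ((hT M _).1 y.2 t ht).elim,
      fun ht => ((he t).2 ht).elim⟩
  refine ⟨T, ⟨IsTerminal.ofUniqueHom (fun X => (exists_hom X T ⊤ fun M x => ?_).choose)
    fun X f => hom_ext fun M x => ?_⟩, fun M => ?_⟩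
  · obtain ⟨y, hy⟩ := hU M
    exact ⟨y, BoundedFormula.realize_top.2 trivial, fun z _ => hy z⟩
  · obtain ⟨y, hy⟩ := hU M
    rw [hy (app f x), hy (app _ x)]
  · obtain ⟨y, hy⟩ := hU M
    exact ⟨⟨⟨y⟩, hy⟩⟩

/-- The formula `f(&0) = g(&1)`. -/
noncomputable def agreeFrm (f : X ⟶ Z) (g : Y ⟶ Z) : Frm 2 :=
  ∃' (rn (graph f) ![0, 2] ⊓ rn (graph g) ![1, 2])

theorem sat_agreeFrm {f : X ⟶ Z} {g : Y ⟶ Z} {x : X.Elem M} {y : Y.Elem M} :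
    Sat₂ (agreeFrm f g) x.1 y.1 ↔ app f x = app g y := by
  simp only [Sat₂, agreeFrm, BoundedFormula.realize_ex, BoundedFormula.realize_inf, snoc_two,
    realize_rn₂]
  change (∃ z, Sat₂ (graph f) x.1 z ∧ Sat₂ (graph g) y.1 z) ↔ _
  simp only [sat_graph_left]
  exact ⟨by rintro ⟨z, h, rfl⟩; exact Subtype.ext h, fun h => ⟨_, congrArg _ h, rfl⟩⟩

/-- The arrow sends `z` to the unique `w` with the prescribed projections, which is a definable
condition. With `p = q` and `f = g` this becomes factorization through a monomorphism. -/
theorem exists_lift {W : DCL} (p : W ⟶ X) (q : W ⟶ Y) (f : Z ⟶ X) (g : Z ⟶ Y)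
    (h : ∀ (M : ZFModel) (z : Z.Elem M),
      ∃! w : W.Elem M, app p w = app f z ∧ app q w = app g z) :
    ∃ k : Z ⟶ W, k ≫ p = f ∧ k ≫ q = g := by
  have hs : ∀ (M : ZFModel) (z : Z.Elem M) (w : W.Elem M),
      Sat₂ (agreeFrm f p ⊓ agreeFrm g q) z.1 w.1 ↔ app p w = app f z ∧ app q w = app g z := by
    intro M z w
    rw [Sat₂, BoundedFormula.realize_inf, eq_comm, @eq_comm _ (app q w)]
    exact and_congr sat_agreeFrm sat_agreeFrm
  obtain ⟨k, hk⟩ := exists_hom Z W (agreeFrm f p ⊓ agreeFrm g q) fun M z => by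
    simpa only [hs] using h M z
  simp only [hs] at hk
  exact ⟨k, hom_ext fun M z => by rw [app_comp, (hk M z).1],
    hom_ext fun M z => by rw [app_comp, (hk M z).2]⟩

/-- In every model, `(p, q)` tabulates the relation `f(x) = g(y)`. -/
def IsPullbackInModels {W : DCL} (p : W ⟶ X) (q : W ⟶ Y) (f : X ⟶ Z) (g : Y ⟶ Z) : Prop :=
  ∀ M : ZFModel, (∀ w w' : W.Elem M, app p w = app p w' → app q w = app q w' → w = w') ∧
    ∀ (x : X.Elem M) (y : Y.Elem M), app f x = app g y ↔ ∃ w, app p w = x ∧ app q w = y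

theorem exists_isPullbackInModels (f : X ⟶ Z) (g : Y ⟶ Z) :
    ∃ (W : DCL) (p : W ⟶ X) (q : W ⟶ Y), IsPullbackInModels p q f g := by
  simpa only [sat_agreeFrm, IsPullbackInModels] using exists_tabulation X Y (agreeFrm f g)

theorem IsPullbackInModels.isPullback {W : DCL} {p : W ⟶ X} {q : W ⟶ Y} {f : X ⟶ Z} {g : Y ⟶ Z}
    (h : IsPullbackInModels p q f g) : IsPullback p q f g := by
  have hw : p ≫ f = q ≫ g := hom_ext fun M w => by
    rw [app_comp, app_comp]
    exact ((h M).2 _ _).2 ⟨w, rfl, rfl⟩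
  have hl : ∀ {V : DCL} (a : V ⟶ X) (b : V ⟶ Y), a ≫ f = b ≫ g →
      ∃ k : V ⟶ W, k ≫ p = a ∧ k ≫ q = b := fun a b hab =>
    exists_lift p q a b fun M v => by
      obtain ⟨w, h₁, h₂⟩ := ((h M).2 (app a v) (app b v)).1 (by
        rw [← app_comp, hab, app_comp])
      exact ⟨w, ⟨h₁, h₂⟩, fun w' hw' =>
        (h M).1 _ _ (hw'.1.trans h₁.symm) (hw'.2.trans h₂.symm)⟩
  refine ⟨⟨hw⟩, ⟨PullbackCone.IsLimit.mk hw (fun s => (hl s.fst s.snd s.condition).choose)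
    (fun s => (hl s.fst s.snd s.condition).choose_spec.1)
    (fun s => (hl s.fst s.snd s.condition).choose_spec.2) fun s m h₁ h₂ => hom_ext fun M v => ?_⟩⟩
  obtain ⟨h₁', h₂'⟩ := (hl s.fst s.snd s.condition).choose_spec
  refine (h M).1 _ _ ?_ ?_
  · rw [← app_comp, ← app_comp, h₁, h₁']
  · rw [← app_comp, ← app_comp, h₂, h₂']

/-- A given pullback is isomorphic to a tabulated one, and `app` turns the isomorphism into a
bijection compatible with the projections. -/
theorem isPullback_iff {W : DCL} {p : W ⟶ X} {q : W ⟶ Y} {f : X ⟶ Z} {g : Y ⟶ Z} :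
    IsPullback p q f g ↔ IsPullbackInModels p q f g := by
  refine ⟨fun h M => ?_, IsPullbackInModels.isPullback⟩
  obtain ⟨W', p', q', h'⟩ := exists_isPullbackInModels f g
  let i := h.isoIsPullback _ _ h'.isPullback
  have hp : ∀ w : W.Elem M, app p' (app i.hom w) = app p w := fun w => by
    rw [← app_comp, h.isoIsPullback_hom_fst]
  have hq : ∀ w : W.Elem M, app q' (app i.hom w) = app q w := fun w => by
    rw [← app_comp, h.isoIsPullback_hom_snd]
  have hi : ∀ w : W.Elem M, app i.inv (app i.hom w) = w := fun w => by
    rw [← app_comp, i.hom_inv_id, app_id]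
  refine ⟨fun w w' h₁ h₂ => ?_, fun x y => ⟨fun hxy => ?_, ?_⟩⟩
  · rw [← hi w, ← hi w', (h' M).1 (app i.hom w) (app i.hom w') (by rw [hp, hp, h₁])
      (by rw [hq, hq, h₂])]
  · obtain ⟨w, rfl, rfl⟩ := ((h' M).2 x y).1 hxy
    refine ⟨app i.inv w, ?_, ?_⟩
    · rw [← app_comp, h.isoIsPullback_inv_fst]
    · rw [← app_comp, h.isoIsPullback_inv_snd]
  · rintro ⟨w, rfl, rfl⟩
    rw [← app_comp, h.w, app_comp]

/-- For a monomorphism the two identities form a kernel pair, and its elementwise description is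
injectivity. -/
theorem mono_iff {f : X ⟶ Y} :
    Mono f ↔ ∀ (M : ZFModel) (x x' : X.Elem M), app f x = app f x' → x = x' := by
  constructor
  · intro _ M x x' h
    obtain ⟨w, h₁, h₂⟩ := ((isPullback_iff.1 (IsKernelPair.id_of_mono f) M).2 x x').1 h
    rw [← h₁, ← h₂]
  · refine fun h => ⟨fun a b hab => hom_ext fun M x => h M _ _ ?_⟩
    rw [← app_comp, ← app_comp, hab]

theorem nonempty_unique_of_isTerminal {T : DCL} (hT : IsTerminal T) (M : ZFModel) :
    Nonempty (Unique (T.Elem M)) := by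
  obtain ⟨T', ⟨hT'⟩, h⟩ := exists_terminal
  obtain ⟨u⟩ := h M
  let i := hT.uniqueUpToIso hT'
  refine ⟨⟨⟨app i.inv u.default⟩, fun x => ?_⟩⟩
  change x = app i.inv u.default
  rw [← u.eq_default (app i.hom x), ← app_comp, i.hom_inv_id, app_id]

instance : HasFiniteLimits DCL := by
  obtain ⟨T, ⟨hT⟩, -⟩ := exists_terminal
  have := hT.hasTerminal
  have : HasPullbacks DCL := by
    refine @hasPullbacks_of_hasLimit_cospan _ _ fun {X Y Z f g} => ?_
    obtain ⟨W, p, q, h⟩ := exists_isPullbackInModels f g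
    exact h.isPullback.hasPullback
  exact hasFiniteLimits_of_hasTerminal_and_pullbacks

/-- A product is a pullback over the terminal object, so its elements are described by
`isPullback_iff`. -/
theorem prod_ext {w w' : (X ⨯ Y).Elem M}
    (h₁ : app (prod.fst : X ⨯ Y ⟶ X) w = app prod.fst w')
    (h₂ : app (prod.snd : X ⨯ Y ⟶ Y) w = app prod.snd w') : w = w' :=
  (isPullback_iff.1 (IsPullback.of_hasBinaryProduct' X Y) M).1 w w' h₁ h₂

theorem exists_prod (x : X.Elem M) (y : Y.Elem M) :
    ∃ w : (X ⨯ Y).Elem M, app prod.fst w = x ∧ app prod.snd w = y := by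
  refine ((isPullback_iff.1 (IsPullback.of_hasBinaryProduct' X Y) M).2 x y).1 ?_
  obtain ⟨u⟩ := nonempty_unique_of_isTerminal (terminalIsTerminal (C := DCL)) M
  rw [u.eq_default (app _ x), u.eq_default (app _ y)]

/-! ### Regularity -/

theorem exists_image (f : X ⟶ Y) : ∃ (I : DCL) (e : X ⟶ I) (m : I ⟶ Y), e ≫ m = f ∧ Mono m ∧
    ∀ (M : ZFModel) (y : I.Elem M), ∃ x : X.Elem M, app e x = y := by
  -- The range of `f` is encoded as a part of the diagonal of `Y`, so that tabulation applies; the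
  -- two legs `m` and `q` then coincide.
  obtain ⟨I, m, q, h⟩ := exists_tabulation Y Y (eq 0 1 ⊓ ∃' rn (graph f) ![2, 0])
  have hs : ∀ (M : ZFModel) (y y' : Y.Elem M),
      Sat₂ (eq 0 1 ⊓ ∃' rn (graph f) ![2, 0]) y.1 y'.1 ↔ y = y' ∧ ∃ x, app f x = y := by
    intro M y y'
    simp only [Sat₂, BoundedFormula.realize_inf, BoundedFormula.realize_ex, snoc_two, realize_rn₂,
      realize_eq]
    refine and_congr Subtype.ext_iff.symm ⟨?_, ?_⟩
    · rintro ⟨x, hx⟩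
      obtain ⟨a, -, ha⟩ := sat_graph.1 hx
      exact ⟨a, Subtype.ext ha⟩
    · rintro ⟨x, rfl⟩
      exact ⟨x.1, app_eq_iff.1 rfl⟩
  simp only [hs] at h
  have hq : ∀ (M : ZFModel) (w : I.Elem M), app q w = app m w := fun M w =>
    (((h M).2 (app m w) (app q w)).2 ⟨w, rfl, rfl⟩).1.symm
  simp only [hq] at h
  have hm : ∀ (M : ZFModel) (w w' : I.Elem M), app m w = app m w' → w = w' :=
    fun M w w' e => (h M).1 w w' e e
  obtain ⟨e, he, -⟩ := exists_lift m m f f fun M x => by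
    obtain ⟨w, hw, -⟩ := ((h M).2 (app f x) (app f x)).1 ⟨rfl, x, rfl⟩
    exact ⟨w, ⟨hw, hw⟩, fun w' hw' => hm M _ _ (hw'.1.trans hw.symm)⟩
  refine ⟨I, e, m, he, mono_iff.2 hm, fun M y => ?_⟩
  obtain ⟨-, x, hx⟩ := ((h M).2 (app m y) (app m y)).2 ⟨y, rfl, rfl⟩
  exact ⟨x, hm M _ _ (by rw [← app_comp, he, hx])⟩

/-- An arrow out of `X` that is constant on the fibres of a surjection `e` factors through it. -/
theorem exists_desc {e : X ⟶ Y} (he : ∀ (M : ZFModel) (y : Y.Elem M), ∃ x, app e x = y)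
    (f : X ⟶ Z) (h : ∀ (M : ZFModel) (x x' : X.Elem M), app e x = app e x' → app f x = app f x') :
    ∃ k : Y ⟶ Z, e ≫ k = f := by
  have hs : ∀ (M : ZFModel) (y : Y.Elem M) (z : Z.Elem M),
      Sat₂ (∃' (rn (graph e) ![2, 0] ⊓ rn (graph f) ![2, 1])) y.1 z.1 ↔
        ∃ x, app e x = y ∧ app f x = z := by
    intro M y z
    simp only [Sat₂, BoundedFormula.realize_inf, BoundedFormula.realize_ex, snoc_two, realize_rn₂]
    constructor
    · rintro ⟨x, hx, hx'⟩
      obtain ⟨a, rfl, ha⟩ := sat_graph.1 hx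
      exact ⟨a, Subtype.ext ha, Subtype.ext (sat_graph_left.1 hx')⟩
    · rintro ⟨x, rfl, rfl⟩
      exact ⟨x.1, app_eq_iff.1 rfl, app_eq_iff.1 rfl⟩
  obtain ⟨k, hk⟩ := exists_hom Y Z (∃' (rn (graph e) ![2, 0] ⊓ rn (graph f) ![2, 1])) fun M y => by
    simp only [hs]
    obtain ⟨x, hx⟩ := he M y
    refine ⟨app f x, ⟨x, hx, rfl⟩, ?_⟩
    rintro _ ⟨x', hx', rfl⟩
    exact h M _ _ (hx'.trans hx.symm)
  simp only [hs] at hk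
  refine ⟨k, hom_ext fun M x => ?_⟩
  obtain ⟨x', hx', h'⟩ := hk M (app e x)
  rw [app_comp, ← h', h M _ _ hx']

/-- `exists_desc` gives the factorizations and surjectivity their uniqueness. The pair `a`, `b` has
to cover the kernel relation of `e` but need not be jointly monic. -/
theorem nonempty_isColimit_of_surjective {e : X ⟶ Y}
    (he : ∀ (M : ZFModel) (y : Y.Elem M), ∃ x, app e x = y) {W : DCL} {a b : W ⟶ X}
    (hab : ∀ (M : ZFModel) (x x' : X.Elem M),
      app e x = app e x' ↔ ∃ w, app a w = x ∧ app b w = x') :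
    ∃ w : a ≫ e = b ≫ e, Nonempty (IsColimit (Cofork.ofπ e w)) := by
  have hw : a ≫ e = b ≫ e := hom_ext fun M w => by
    rw [app_comp, app_comp]
    exact (hab M _ _).2 ⟨w, rfl, rfl⟩
  have hd : ∀ s : Cofork a b, ∃ k, e ≫ k = s.π := fun s => exists_desc he s.π fun M x x' h => by
    obtain ⟨w, rfl, rfl⟩ := (hab M _ _).1 h
    rw [← app_comp, s.condition, app_comp]
  refine ⟨hw, ⟨Cofork.IsColimit.mk _ (fun s => (hd s).choose) (fun s => (hd s).choose_spec)
    fun s m hm => hom_ext fun M y => ?_⟩⟩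
  obtain ⟨x, rfl⟩ := he M y
  rw [← app_comp, ← app_comp, (hd s).choose_spec]
  exact app_eq_of_eq hm x

/-- Let `f = e ≫ m` be the image factorization of a regular epimorphism. As `m` is monic, `e`
coequalizes the pair presenting `f`, hence factors as `f ≫ d`. Then `d ≫ m` is the identity, and
surjectivity of `e` passes to `f`. Conversely, a surjection is the coequalizer of its kernel pair.
-/
theorem isRegularEpi_iff {f : X ⟶ Y} :
    IsRegularEpi f ↔ ∀ (M : ZFModel) (y : Y.Elem M), ∃ x, app f x = y := by
  constructor
  · rintro ⟨⟨r⟩⟩ M y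
    obtain ⟨I, e, m, rfl, hm, he⟩ := exists_image f
    have hw : r.left ≫ e = r.right ≫ e := by
      rw [← cancel_mono m, Category.assoc, Category.assoc, r.w]
    let d : Y ⟶ I := Cofork.IsColimit.desc r.isColimit e hw
    have hd : (e ≫ m) ≫ d = e := Cofork.IsColimit.π_desc' r.isColimit e hw
    have hdm : d ≫ m = 𝟙 Y := Cofork.IsColimit.hom_ext r.isColimit (by
      change (e ≫ m) ≫ d ≫ m = (e ≫ m) ≫ 𝟙 Y
      rw [← Category.assoc, hd, Category.comp_id])
    obtain ⟨x, hx⟩ := he M (app d y)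
    exact ⟨x, by rw [app_comp, hx, ← app_comp, hdm, app_id]⟩
  · intro h
    obtain ⟨W, p, q, hW⟩ := exists_isPullbackInModels f f
    obtain ⟨hw, ⟨hc⟩⟩ := nonempty_isColimit_of_surjective h fun M x x' => (hW M).2 x x'
    exact ⟨⟨⟨W, p, q, hw, hc⟩⟩⟩

/-- An arrow and the surjective part of its image factorization have the same kernel pair, whose
coequalizer is that surjective part. Base change preserves surjectivity elementwise. -/
instance : Regular DCL where
  hasCoequalizer_of_isKernelPair {X Y Z f a b} h := by
    obtain ⟨I, e, m, rfl, hm, he⟩ := exists_image f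
    obtain ⟨hw, ⟨hc⟩⟩ := nonempty_isColimit_of_surjective he (a := a) (b := b) fun M x x' => by
      rw [← (isPullback_iff.1 h M).2 x x', app_comp, app_comp]
      exact ⟨fun e => by rw [e], fun e => mono_iff.1 hm M _ _ e⟩
    exact ⟨⟨⟨_, hc⟩⟩⟩
  regularEpiIsStableUnderBaseChange := ⟨fun {X Y Y' S f g f' g'} h hg => by
    refine isRegularEpi_iff.2 fun M x => ?_
    obtain ⟨y, hy⟩ := isRegularEpi_iff.1 hg M (app f x)
    obtain ⟨w, -, hw⟩ := ((isPullback_iff.1 h M).2 y x).1 hy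
    exact ⟨w, hw⟩⟩

/-! ### Elements of products and subobjects -/

theorem exists_comp_mono_eq_iff {A : DCL} (m : A ⟶ Y) [hm : Mono m] (f : Z ⟶ Y) :
    (∃ g : Z ⟶ A, g ≫ m = f) ↔ ∀ (M : ZFModel) (z : Z.Elem M), ∃ a, app m a = app f z := by
  constructor
  · rintro ⟨g, rfl⟩ M z
    exact ⟨app g z, (app_comp _ _ _).symm⟩
  · intro h
    obtain ⟨g, hg, -⟩ := exists_lift m m f f fun M z => by
      obtain ⟨a, ha⟩ := h M z
      exact ⟨a, ⟨ha, ha⟩, fun a' ha' => mono_iff.1 hm M _ _ (ha'.1.trans ha.symm)⟩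
    exact ⟨g, hg⟩

/-- Between monomorphisms, a pullback square only says that one subobject is the preimage of the
other. -/
theorem exists_isPullback_iff {A B : DCL} (m : A ⟶ Y) [hm : Mono m] (n : B ⟶ X) [hn : Mono n]
    (f : X ⟶ Y) : (∃ t : B ⟶ A, IsPullback t n m f) ↔
      ∀ (M : ZFModel) (x : X.Elem M), (∃ b, app n b = x) ↔ ∃ a, app m a = app f x := by
  constructor
  · rintro ⟨t, h⟩ M x
    constructor
    · rintro ⟨b, rfl⟩
      exact ⟨app t b, ((isPullback_iff.1 h M).2 _ _).2 ⟨b, rfl, rfl⟩⟩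
    · rintro ⟨a, ha⟩
      obtain ⟨b, -, hb⟩ := ((isPullback_iff.1 h M).2 _ _).1 ha
      exact ⟨b, hb⟩
  · intro h
    obtain ⟨t, ht⟩ := (exists_comp_mono_eq_iff m (n ≫ f)).2 fun M b => by
      rw [app_comp]
      exact (h M _).1 ⟨b, rfl⟩
    refine ⟨t, isPullback_iff.2 fun M => ⟨fun b b' _ hb => mono_iff.1 hn M _ _ hb,
      fun a x => ⟨fun hax => ?_, ?_⟩⟩⟩
    · obtain ⟨b, rfl⟩ := (h M x).2 ⟨a, hax⟩
      refine ⟨b, mono_iff.1 hm M _ _ ?_, rfl⟩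
      rw [← app_comp, ht, app_comp, hax]
    · rintro ⟨b, rfl, rfl⟩
      rw [← app_comp, ht, app_comp]

/-- The pair of two elements, in a product. -/
noncomputable def pr (x : X.Elem M) (y : Y.Elem M) : (X ⨯ Y).Elem M := (exists_prod x y).choose

@[simp]
theorem app_fst_pr (x : X.Elem M) (y : Y.Elem M) : app prod.fst (pr x y) = x :=
  (exists_prod x y).choose_spec.1

@[simp]
theorem app_snd_pr (x : X.Elem M) (y : Y.Elem M) : app prod.snd (pr x y) = y :=
  (exists_prod x y).choose_spec.2

theorem eq_pr_iff {w : (X ⨯ Y).Elem M} {x : X.Elem M} {y : Y.Elem M} :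
    w = pr x y ↔ app (prod.fst : X ⨯ Y ⟶ X) w = x ∧ app (prod.snd : X ⨯ Y ⟶ Y) w = y := by
  constructor
  · rintro rfl
    simp
  · rintro ⟨rfl, rfl⟩
    exact prod_ext (by simp) (by simp)

theorem app_eq_pr_iff {f : Z ⟶ X ⨯ Y} {z : Z.Elem M} {x : X.Elem M} {y : Y.Elem M} :
    app f z = pr x y ↔ app (f ≫ prod.fst) z = x ∧ app (f ≫ prod.snd) z = y := by
  rw [eq_pr_iff, app_comp, app_comp]

theorem app_prod_lift (f : Z ⟶ X) (g : Z ⟶ Y) (z : Z.Elem M) :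
    app (prod.lift f g) z = pr (app f z) (app g z) := by
  rw [app_eq_pr_iff, prod.lift_fst, prod.lift_snd]
  exact ⟨rfl, rfl⟩

theorem app_prod_map_id (f : Y ⟶ Z) (x : X.Elem M) (y : Y.Elem M) :
    app (prod.map (𝟙 X) f) (pr x y) = pr x (app f y) := by
  rw [app_eq_pr_iff, prod.map_fst, prod.map_snd]
  simp

theorem forall_prod {p : (X ⨯ Y).Elem M → Prop} : (∀ w, p w) ↔ ∀ x y, p (pr x y) :=
  ⟨fun h _ _ => h _, fun h w => (eq_pr_iff.2 ⟨rfl, rfl⟩ : w = pr _ _) ▸ h _ _⟩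

/-- The relation between the elements of `X` and `Y` given by `f : Z ⟶ X ⨯ Y`. -/
def Holds (f : Z ⟶ X ⨯ Y) (x : X.Elem M) (y : Y.Elem M) : Prop := ∃ z, app f z = pr x y

/-- This puts the universal property of power objects in terms of relations between elements:
pulling back along `id × f` substitutes `f` in the second argument. -/
theorem exists_isPullback_prod_map_iff {A B P : DCL} (m : A ⟶ X ⨯ P) [Mono m] (n : B ⟶ X ⨯ Z)
    [Mono n] (f : Z ⟶ P) : (∃ t : B ⟶ A, IsPullback t n m (prod.map (𝟙 X) f)) ↔
      ∀ (M : ZFModel) (x : X.Elem M) (z : Z.Elem M), Holds n x z ↔ Holds m x (app f z) := by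
  rw [exists_isPullback_iff]
  simp only [forall_prod, app_prod_map_id]
  rfl

/-- A tabulation, as a subobject of a product. -/
theorem exists_mono_prod (X Y : DCL) (R : Frm 2) : ∃ (W : DCL) (m : W ⟶ X ⨯ Y), Mono m ∧
    ∀ (M : ZFModel) (x : X.Elem M) (y : Y.Elem M), Holds m x y ↔ Sat₂ R x.1 y.1 := by
  obtain ⟨W, p, q, h⟩ := exists_tabulation X Y R
  refine ⟨W, prod.lift p q, mono_iff.2 fun M w w' hw => ?_, fun M x y => ?_⟩
  · rw [app_prod_lift, app_prod_lift, eq_pr_iff, app_fst_pr, app_snd_pr] at hw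
    exact (h M).1 _ _ hw.1 hw.2
  · simp only [(h M).2, Holds, app_eq_pr_iff, prod.lift_fst, prod.lift_snd]

/-! ### Small maps -/

/-- The elements satisfying `p` form a set. -/
def IsSmall (p : X.Elem M → Prop) : Prop :=
  ZFModel.IsSet fun x => ∃ a : X.Elem M, a.1 = x ∧ p a

theorem IsSmall.congr {p q : X.Elem M → Prop} (hp : IsSmall p) (h : ∀ x, p x ↔ q x) :
    IsSmall q := by
  rwa [← show p = q from funext fun x => propext (h x)]

theorem smallMaps_iff (f : X ⟶ Y) :
    smallMaps f ↔ ∀ (M : ZFModel) (y : Y.Elem M), IsSmall fun x => app f x = y := by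
  have e : smallMaps f ↔ Provable ZF (fibresAreSets (graph f)) := by
    conv_lhs => rw [← Quotient.out_eq (s := relSetoid X Y) f]
    rfl
  rw [e, provable_iff]
  simp only [fibresAreSets, BoundedFormula.realize_all, BoundedFormula.realize_ex,
    BoundedFormula.realize_iff, realize_rn₂, realize_mem, snoc_zero, snoc_one, snoc_two]
  constructor
  · intro h M y
    obtain ⟨z, hz⟩ := h M M.isModel default y.1
    refine ⟨z, fun x => (Iff.trans ?_ (hz x))⟩
    refine Iff.trans ?_ sat_graph.symm
    simp only [Subtype.ext_iff]
    rfl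
  · intro h N _ _ hN _ y
    by_cases hy : Sat₁ Y.formula y
    · obtain ⟨z, hz⟩ := h ⟨N, hN⟩ ⟨y, hy⟩
      refine ⟨z, fun x => Iff.trans ?_ (hz x)⟩
      refine (sat_graph (M := ⟨N, hN⟩)).trans ?_
      simp only [Subtype.ext_iff]
      rfl
    -- The defining formula ranges over all `y` in the model; outside `Y` the fibre is empty.
    · obtain ⟨z, hz⟩ := ZFModel.isSet_empty (M := ⟨N, hN⟩)
      refine ⟨z, fun x => Iff.trans ⟨fun h => hy ?_, False.elim⟩ (hz x)⟩
      obtain ⟨a, -, ha⟩ := (sat_graph (M := ⟨N, hN⟩)).1 h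
      have := (app f a).2
      rwa [ha] at this

theorem IsSmall.image {p : X.Elem M → Prop} (hp : IsSmall p) (F : Frm 3) (c : M)
    (h : ∀ (x : X.Elem M) (y y' : Y.Elem M), p x → Sat₃ F c x.1 y.1 → Sat₃ F c x.1 y'.1 → y = y') :
    IsSmall fun y : Y.Elem M => ∃ x, p x ∧ Sat₃ F c x.1 y.1 := by
  have hs : ∀ x y, Sat₃ (F ⊓ rn Y.formula ![2]) c x y ↔ Sat₃ F c x y ∧ Sat₁ Y.formula y := by
    intro x y
    simp only [Sat₃, BoundedFormula.realize_inf, realize_rn₁]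
    rfl
  refine (ZFModel.IsSet.image hp (F ⊓ rn Y.formula ![2]) c ?_).congr fun y => ?_
  · simp only [hs]
    rintro _ y y' ⟨x, rfl, hx⟩ ⟨hF, hy⟩ ⟨hF', hy'⟩
    exact congrArg Subtype.val (h x ⟨y, hy⟩ ⟨y', hy'⟩ hx hF hF')
  · simp only [hs]
    constructor
    · rintro ⟨_, ⟨x, rfl, hx⟩, hF, hy⟩
      exact ⟨⟨y, hy⟩, rfl, x, hx, hF⟩
    · rintro ⟨y, rfl, x, hx, hF⟩
      exact ⟨_, ⟨x, rfl, hx⟩, hF, y.2⟩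

/-- A fibre of the composite is the union of the fibres of `f` over the points of a fibre of `g`. -/
theorem smallMaps_comp (f : X ⟶ Y) (g : Y ⟶ Z) (hf : smallMaps f) (hg : smallMaps g) :
    smallMaps (f ≫ g) := by
  rw [smallMaps_iff] at *
  intro M z
  refine (ZFModel.IsSet.biUnion (hg M z) (graph f) ?_).congr fun x => ?_
  · rintro _ ⟨y, rfl, -⟩
    refine ZFModel.IsSet.congr (hf M y) fun x => ?_
    rw [sat_graph]
    simp only [Subtype.ext_iff]
  · constructor
    · rintro ⟨_, ⟨y, rfl, hy⟩, h⟩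
      obtain ⟨a, rfl, ha⟩ := sat_graph.1 h
      exact ⟨a, rfl, (app_comp f g a).trans ((congrArg _ (Subtype.ext ha)).trans hy)⟩
    · rintro ⟨a, rfl, ha⟩
      exact ⟨_, ⟨app f a, rfl, (app_comp f g a).symm.trans ha⟩, app_eq_iff.1 rfl⟩

theorem smallMaps_of_mono (f : X ⟶ Y) (hf : Mono f) : smallMaps f := by
  refine (smallMaps_iff f).2 fun M y => ZFModel.isSet_of_subsingleton ?_
  rintro _ _ ⟨a, rfl, ha⟩ ⟨b, rfl, hb⟩
  rw [mono_iff.1 hf M a b (ha.trans hb.symm)]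

/-- The formula `f(&2) = &1 ∧ g(&2) = &0`. -/
noncomputable def spanFrm (f : Z ⟶ X) (g : Z ⟶ Y) : Frm 3 :=
  rn (graph f) ![2, 1] ⊓ rn (graph g) ![2, 0]

theorem sat_spanFrm {f : Z ⟶ X} {g : Z ⟶ Y} {x : X.Elem M} {y : Y.Elem M} {z : Z.Elem M} :
    Sat₃ (spanFrm f g) y.1 x.1 z.1 ↔ app f z = x ∧ app g z = y := by
  rw [Sat₃, spanFrm, BoundedFormula.realize_inf, realize_rn₂, realize_rn₂, app_eq_iff, app_eq_iff]
  rfl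

/-- The fibre of `f'` over `y` is the image of the fibre of `f` over `q(y)` under the map taking `x`
to the element with projections `x` and `y`. -/
theorem smallMaps_of_isPullback {X' Y' : DCL} {p : X' ⟶ X} {f' : X' ⟶ Y'} {f : X ⟶ Y} {q : Y' ⟶ Y}
    (h : IsPullback p f' f q) (hf : smallMaps f) : smallMaps f' := by
  refine (smallMaps_iff f').2 fun M y => ?_
  have hM := isPullback_iff.1 h M
  refine (((smallMaps_iff f).1 hf M (app q y)).image (spanFrm p f') y.1 ?_).congr fun a => ?_
  · simp only [sat_spanFrm]
    rintro x a a' - ⟨h₁, h₂⟩ ⟨h₁', h₂'⟩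
    exact hM.1 a a' (h₁.trans h₁'.symm) (h₂.trans h₂'.symm)
  · simp only [sat_spanFrm]
    constructor
    · rintro ⟨x, -, -, ha⟩
      exact ha
    · rintro rfl
      exact ⟨_, (hM.2 _ _).2 ⟨a, rfl, rfl⟩, rfl, rfl⟩

/-- As `m` is monic, its fibre over `y` and the set of `x` related to `y` are in definable
bijection; replacement is used in each direction. -/
theorem smallMaps_comp_snd_iff (m : Z ⟶ X ⨯ Y) [hm : Mono m] : smallMaps (m ≫ prod.snd) ↔
    ∀ (M : ZFModel) (y : Y.Elem M), IsSmall fun x : X.Elem M => Holds m x y := by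
  rw [smallMaps_iff]
  refine forall_congr' fun M => forall_congr' fun y => ⟨fun h => ?_, fun h => ?_⟩
  · have hs : ∀ (z : Z.Elem M) (x : X.Elem M),
        Sat₃ (rn (graph (m ≫ prod.fst)) ![1, 2]) y.1 z.1 x.1 ↔ app (m ≫ prod.fst) z = x := by
      intro z x
      rw [Sat₃, realize_rn₂, app_eq_iff]
      rfl
    refine (h.image (rn (graph (m ≫ prod.fst)) ![1, 2]) y.1 ?_).congr fun x => ?_
    · simp only [hs]
      rintro z x _ - rfl rfl
      rfl
    · simp only [hs, Holds, app_eq_pr_iff]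
      exact exists_congr fun z => and_comm
  · refine (h.image (spanFrm (m ≫ prod.fst) (m ≫ prod.snd)) y.1 ?_).congr fun z => ?_
    · simp only [sat_spanFrm, ← app_eq_pr_iff]
      intro x z z' _ hz hz'
      exact mono_iff.1 hm M z z' (hz.trans hz'.symm)
    · simp only [sat_spanFrm]
      exact ⟨fun ⟨_, _, _, h⟩ => h, fun h => ⟨_, ⟨z, app_eq_pr_iff.2 ⟨rfl, h⟩⟩, rfl, h⟩⟩

/-! ### Power objects -/

/-- The class of subsets of a class. -/
def powerClass (X : DCL) : DCL := ⟨∀' (mem 1 0 ⟹ rn X.formula ![1])⟩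

theorem sat_powerClass {z : M} :
    Sat₁ (powerClass X).formula z ↔ ∀ t, IsMem t z → Sat₁ X.formula t := by
  simp only [Sat₁, powerClass, BoundedFormula.realize_all, BoundedFormula.realize_imp, snoc_one,
    realize_mem, realize_rn₁]
  rfl

theorem powerClass_ext {a b : (powerClass X).Elem M}
    (h : ∀ x : X.Elem M, IsMem x.1 a.1 ↔ IsMem x.1 b.1) : a = b :=
  Subtype.ext (ZFModel.ext_mem fun t => ⟨fun ht => (h ⟨t, sat_powerClass.1 a.2 t ht⟩).1 ht,
    fun ht => (h ⟨t, sat_powerClass.1 b.2 t ht⟩).2 ht⟩)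

theorem exists_membership (X : DCL) : ∃ (E : DCL) (e : E ⟶ X ⨯ powerClass X), Mono e ∧
    ∀ (M : ZFModel) (x : X.Elem M) (a : (powerClass X).Elem M),
      Holds e x a ↔ IsMem x.1 a.1 := by
  obtain ⟨E, e, he, h⟩ := exists_mono_prod X (powerClass X) (mem 0 1)
  refine ⟨E, e, he, fun M x a => (h M x a).trans ?_⟩
  rw [Sat₂, realize_mem]
  rfl

/-- The arrow `y ↦ {x | m relates x and y}`. -/
theorem exists_classifier (m : Z ⟶ X ⨯ Y) [Mono m] (hm : smallMaps (m ≫ prod.snd)) :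
    ∃ f : Y ⟶ powerClass X, ∀ (M : ZFModel) (x : X.Elem M) (y : Y.Elem M),
      Holds m x y ↔ IsMem x.1 (app f y).1 := by
  -- The formula says that `&1` is the set of all `x` related to `&0`. Smallness makes such a set
  -- exist, and extensionality makes it unique.
  let F : Frm 2 := ∀' (mem 2 1 ⇔
    ∃' (rn (graph (m ≫ prod.fst)) ![3, 2] ⊓ rn (graph (m ≫ prod.snd)) ![3, 0]))
  have hs : ∀ (M : ZFModel) (y : Y.Elem M) (a : M), Sat₂ F y.1 a ↔
      ∀ t, IsMem t a ↔ ∃ x : X.Elem M, x.1 = t ∧ Holds m x y := by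
    intro M y a
    simp only [Sat₂, F, BoundedFormula.realize_all, BoundedFormula.realize_iff,
      BoundedFormula.realize_ex, BoundedFormula.realize_inf, snoc_two, snoc_three, realize_mem,
      realize_rn₂]
    refine forall_congr' fun t => iff_congr Iff.rfl ?_
    constructor
    · rintro ⟨z, h₁, h₂⟩
      obtain ⟨z, rfl, rfl⟩ := sat_graph.1 h₁
      exact ⟨_, rfl, z, app_eq_pr_iff.2 ⟨rfl, Subtype.ext (sat_graph_left.1 h₂)⟩⟩
    · rintro ⟨x, rfl, z, hz⟩
      obtain ⟨h₁, h₂⟩ := app_eq_pr_iff.1 hz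
      exact ⟨z.1, app_eq_iff.1 h₁, app_eq_iff.1 h₂⟩
  obtain ⟨f, hf⟩ := exists_hom Y (powerClass X) F fun M y => by
    obtain ⟨a, ha⟩ := (smallMaps_comp_snd_iff m).1 hm M y
    simp only [hs]
    refine ⟨⟨a, sat_powerClass.2 fun t ht => ?_⟩, fun t => (ha t).symm, fun b hb => ?_⟩
    · obtain ⟨x, rfl, -⟩ := (ha t).2 ht
      exact x.2
    · exact Subtype.ext (ZFModel.ext_mem fun t => (hb t).trans (ha t))
  simp only [hs] at hf
  refine ⟨f, fun M x y => ?_⟩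
  rw [hf M y]
  exact ⟨fun h => ⟨x, rfl, h⟩, fun ⟨x', hx', h⟩ => Subtype.ext hx' ▸ h⟩

/-- The membership relation is small because its fibre over a subset `a` is `a` itself. -/
theorem isPowerObject_of_holds_iff_mem {E : DCL} (e : E ⟶ X ⨯ powerClass X) [he : Mono e]
    (h : ∀ (M : ZFModel) (x : X.Elem M) (a : (powerClass X).Elem M),
      Holds e x a ↔ IsMem x.1 a.1) : IsPowerObject smallMaps e where
  mono := he
  small := by
    refine (smallMaps_comp_snd_iff e).2 fun M a => (ZFModel.isSet_mem a.1).congr fun t => ?_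
    simp only [h]
    refine ⟨fun ht => ⟨⟨t, sat_powerClass.1 a.2 t ht⟩, rfl, ht⟩, ?_⟩
    rintro ⟨x, rfl, hx⟩
    exact hx
  existsUnique_pullback {Z R} ψ hψ hs := by
    simp only [exists_isPullback_prod_map_iff, h]
    obtain ⟨f, hf⟩ := exists_classifier ψ hs
    exact ⟨f, hf, fun g hg => hom_ext fun M z => powerClass_ext fun x =>
      (hg M x z).symm.trans (hf M x z)⟩

/-- Every power object embeds into the class of subsets. -/
theorem IsPowerObject.exists_mono {P E : DCL} {e : E ⟶ X ⨯ P} (he : IsPowerObject smallMaps e) :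
    ∃ f : P ⟶ powerClass X, Mono f ∧ ∀ (M : ZFModel) (x : X.Elem M) (a : P.Elem M),
      Holds e x a ↔ IsMem x.1 (app f a).1 := by
  have := he.mono
  obtain ⟨E', e', he', h⟩ := exists_membership X
  obtain ⟨f, hf⟩ := exists_classifier e he.small
  obtain ⟨g, hg, -⟩ := he.existsUnique_pullback e' he'
    (isPowerObject_of_holds_iff_mem e' h).small
  have hu := he.existsUnique_pullback e he.mono he.small
  simp only [exists_isPullback_prod_map_iff] at hg hu
  -- Here `f` classifies `e` by subsets and `g` classifies true membership by `e`. Pulling `e` back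
  -- along `f ≫ g` returns `e`, so uniqueness gives the identity, and `f` is a split monomorphism.
  have hfg : f ≫ g = 𝟙 P := hu.unique (fun M x a => by rw [app_comp, ← hg, h, hf])
    (fun M x a => by rw [app_id])
  have : Mono (f ≫ g) := hfg ▸ inferInstance
  exact ⟨f, mono_of_mono f g, hf⟩

/-- The embedding `f` into the class of subsets turns the abstract elements of `P` into actual sets,
whose inclusion is definable. -/
theorem exists_inclusion {P E : DCL} (e : E ⟶ X ⨯ P) (he : IsPowerObject smallMaps e) :
    ∃ (Q : DCL) (s : Q ⟶ P ⨯ P), IsInclusion e s ∧ smallMaps (s ≫ prod.snd) := by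
  have := he.mono
  obtain ⟨f, hm, hf⟩ := IsPowerObject.exists_mono he
  obtain ⟨Q, s, hs, hQ⟩ := exists_mono_prod P P
    (∃' ∃' (rn (graph f) ![0, 2] ⊓ (rn (graph f) ![1, 3] ⊓ ∀' (mem 4 2 ⟹ mem 4 3))))
  replace hQ : ∀ (M : ZFModel) (a b : P.Elem M),
      Holds s a b ↔ ∀ t, IsMem t (app f a).1 → IsMem t (app f b).1 := by
    intro M a b
    rw [hQ]
    simp only [Sat₂, BoundedFormula.realize_all, BoundedFormula.realize_imp,
      BoundedFormula.realize_ex, BoundedFormula.realize_inf, snoc_two, snoc_three, snoc_four,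
      realize_mem, realize_rn₂]
    constructor
    · rintro ⟨u, v, hu, hv, h⟩
      rw [sat_graph_left.1 hu, sat_graph_left.1 hv]
      exact h
    · exact fun h => ⟨_, _, app_eq_iff.1 rfl, app_eq_iff.1 rfl, h⟩
  refine ⟨Q, s, ⟨hs, fun {Z A B} f₁ f₂ a π b π' h₁ h₂ => ?_⟩, ?_⟩
  · have hπ : Mono π := h₁.mono_snd_of_mono
    have hπ' : Mono π' := h₂.mono_snd_of_mono
    have h₁' := (exists_isPullback_prod_map_iff e π f₁).1 ⟨a, h₁⟩
    have h₂' := (exists_isPullback_prod_map_iff e π' f₂).1 ⟨b, h₂⟩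
    have hk : (∃ k : A ⟶ B, k ≫ π' = π) ↔ ∀ (M : ZFModel) (x : X.Elem M) (z : Z.Elem M),
        Holds π x z → Holds π' x z := by
      rw [exists_comp_mono_eq_iff]
      constructor
      · rintro h M x z ⟨w, hw⟩
        obtain ⟨b, hb⟩ := h M w
        exact ⟨b, hb.trans hw⟩
      · intro h M w
        have hw := eq_pr_iff (w := app π w).2 ⟨rfl, rfl⟩
        obtain ⟨b, hb⟩ := h M _ _ ⟨w, hw⟩
        exact ⟨b, hb.trans hw.symm⟩
    rw [hk, exists_comp_mono_eq_iff]
    simp only [app_prod_lift]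
    constructor
    · intro h M x z hx
      rw [h₁', hf] at hx
      rw [h₂', hf]
      exact (hQ M _ _).1 (h M z) _ hx
    · intro h M z
      refine (hQ M _ _).2 fun t ht => ?_
      -- An element of the set `f(f₁(z))` is a member of `X`, so the hypothesis applies to it.
      have := h M ⟨t, sat_powerClass.1 (app f (app f₁ z)).2 t ht⟩ z
      rw [h₁', h₂', hf, hf] at this
      exact this ht
  · refine (smallMaps_comp_snd_iff s).2 fun M b => ?_
    have hg : ∀ u a : M, Sat₃ (rn (graph f) ![2, 1]) b.1 u a ↔
        ∃ c : P.Elem M, c.1 = a ∧ (app f c).1 = u := by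
      intro u a
      rw [Sat₃, realize_rn₂, ← sat_graph]
      rfl
    -- The elements below `b` form the image of the powerset of `f(b)` under the partial inverse of
    -- `f`; injectivity of `f` is all that replacement needs.
    refine ((ZFModel.isSet_powerset (app f b).1).image (rn (graph f) ![2, 1]) b.1 ?_).congr
      fun a => ?_
    · simp only [hg]
      rintro _ _ _ - ⟨c, rfl, rfl⟩ ⟨c', rfl, hc⟩
      rw [mono_iff.1 hm M c' c (Subtype.ext hc)]
    · simp only [hg, hQ]
      constructor
      · rintro ⟨_, hu, c, rfl, rfl⟩
        exact ⟨c, rfl, hu⟩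
      · rintro ⟨c, rfl, hu⟩
        exact ⟨_, hu, c, rfl, rfl⟩

/-! ### Assembly of the axioms, and small classes. -/

theorem isClassOfSmallMaps_smallMaps : IsClassOfSmallMaps smallMaps where
  comp := smallMaps_comp
  mono := smallMaps_of_mono
  stability := smallMaps_of_isPullback
  representability X := by
    obtain ⟨E, e, he, h⟩ := exists_membership X
    exact ⟨_, E, e, isPowerObject_of_holds_iff_mem e h⟩
  powerset := exists_inclusion

/-- A terminal class has exactly one member in each model, so the only fibre is all of `X`. -/
theorem smallMaps_from_iff (X T : DCL) (hT : IsTerminal T) :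
    smallMaps (hT.from X) ↔ X.IsDefinableSet := by
  rw [smallMaps_iff, IsDefinableSet, provable_iff]
  simp only [BoundedFormula.realize_all, BoundedFormula.realize_ex, BoundedFormula.realize_iff,
    realize_rn₁, realize_mem, snoc_zero, snoc_one]
  have hs : ∀ (M : ZFModel) (y : T.Elem M) (x : M),
      (∃ a : X.Elem M, a.1 = x ∧ app (hT.from X) a = y) ↔ Sat₁ X.formula x := by
    intro M y x
    obtain ⟨u⟩ := nonempty_unique_of_isTerminal hT M
    refine ⟨?_, fun hx => ⟨⟨x, hx⟩, rfl, ?_⟩⟩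
    · rintro ⟨a, rfl, -⟩
      exact a.2
    · rw [u.eq_default (app _ _), u.eq_default y]
  constructor
  · intro h N _ _ hN _
    obtain ⟨u⟩ := nonempty_unique_of_isTerminal hT ⟨N, hN⟩
    obtain ⟨z, hz⟩ := h ⟨N, hN⟩ u.default
    exact ⟨z, fun x => ((hs ⟨N, hN⟩ _ x).symm.trans (hz x)).symm⟩
  · intro h M y
    obtain ⟨z, hz⟩ := h M M.isModel default
    exact ⟨z, fun x => (hs M y x).trans (hz x).symm⟩

end DCL

end ZFClasses

theorem mainTheorem3 :
    ∃ _ : Regular ZFClasses.DCL,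
      ZFClasses.IsClassOfSmallMaps ZFClasses.DCL.smallMaps ∧
      ∀ (X T : ZFClasses.DCL) (hT : IsTerminal T),
        ZFClasses.DCL.smallMaps (hT.from X) ↔ X.IsDefinableSet :=
  ⟨inferInstance, ZFClasses.DCL.isClassOfSmallMaps_smallMaps,
    ZFClasses.DCL.smallMaps_from_iff⟩
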